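/- **Setting.** Let $N_x\ge 1$, let $m_0,m_1,m_2\ge 1$ be coarsening factors, let $N_3\ge 2$, and let $N_\ell=m_\ell(N_{\ell+1}-1)+1$ for $\ell=2,1,0$ be the numbers of time points on the levels. Let $\Phi_0,\dots,\Phi_3$ be $N_x\times N_x$ matrices (real or complex). On level $\ell$ with time points $0,\dots,N_\ell-1$, the C-points are the multiples of $m_\ell$ and all other points are F-points. Define block matrices with $N_x\times N_x$ blocks: * $A_\ell$ has diagonal blocks $I$, first subdiagonal blocks $-\Phi_\ell$, and zero blocks elsewhere; * $P_\ell$ has block $(p,c)$ equal to $\Phi_\ell^{\,p-cm_\ell}$ if $cm_\ell\le p<(c+1)m_\ell$, else $0$; * $R_\ell$ has block $(c,p)$ equal to $\Phi_\ell^{\,cm_\ell-p}$ if $(c-1)m_\ell<p\le cm_\ell$, else $0$; * $R_{I_\ell}$ has block $(c,p)$ equal to $I$ if $p=cm_\ell$, else $0$; * $S_\ell$ embeds the F-points into all points, and $Q_\ell=S_\ell(S_\ell^TA_\ell S_\ell)^{-1}S_\ell^T$. The four-level MGRIT V-cycle with F-relaxation for $A_0u=g$ is the following recursion. On level $\ell<3$,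 for $A_\ell x=b$, replace $x$ by $y=x+Q_\ell(b-A_\ell x)$, compute $z$ by the V-cycle on level $\ell+1$ with right-hand side $R_\ell(b-A_\ell y)$ and zero initial guess, and return $y+P_\ell z$; on level $3$ solve exactly. Let $u_0,u_1,\dots$ be the iterates from an initial guess $u_0$ and $r_i=g-A_0u_i$. The worst-case convergence factor $c_f$ is the supremum of $\|r_{i+1}\|_2/\|r_i\|_2$ (with $0/0=0$) over all $g$, all $u_0$ and all $i\ge 0$, where $i=0$ is included only for those $u_0$ whose residual $r_0$ vanishes at the F-points of level $0$ (as after F-relaxation of the initial guess). The error propagator is $$\mathcal E_F^{4}=P_0R_{I_0}-\big(P_0P_1P_2A_3^{-1}R_2R_1R_0+P_0Q_1R_0+P_0P_1Q_2R_1R_0\big)A_0P_0R_{I_0},$$ and $\mathcal E_F^{4,\Delta}=R_{I_0}\mathcal E_F^{4}P_0$ is the propagator on level $1$. **Theorem.** Suppose that $\Phi_\ell=X\,\mathrm{diag}(\lambda_{\ell,1},\dots,\lambda_{\ell,N_x})X^*$, $\ell=0,\dots,3$, with one unitary $X$, and $|\lambda_{\ell,k}|<1$ for all $\ell,k$. Let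 $\|\mathcal E_F^{4,\Delta}\|_1$ and $\|\mathcal E_F^{4,\Delta}\|_\infty$ denote the maximal absolute column sum and row sum of $\mathcal E_F^{4,\Delta}$ written in the common eigenbasis, i.e. with each $\Phi_\ell$ replaced by $\mathrm{diag}(\lambda_{\ell,1},\dots,\lambda_{\ell,N_x})$. Then $$c_f\le\sqrt{\|\mathcal E_F^{4,\Delta}\|_1\,\|\mathcal E_F^{4,\Delta}\|_\infty},$$ $$\|\mathcal E_F^{4,\Delta}\|_1=\max_{1\le k\le N_x,\;0\le d\le m_1m_2-1}s^{\rm col}_d(k),\qquad \|\mathcal E_F^{4,\Delta}\|_\infty=\max_{1\le k\le N_x,\;1\le t\le m_1m_2}s^{\rm row}_{N_1-1-m_1m_2+t}(k),$$ where $s^{\rm col}_d(k)$ and $s^{\rm row}_p(k)$, the absolute sums of the column and row of $\mathcal E_F^{4,\Delta}$ (in the eigenbasis) belonging to mode $k$ and time point $d$ resp. $p$ of level $1$, are given as follows. Fix $k$ and write $\lambda_\ell=\lambda_{\ell,k}$, $a=|\lambda_1|$, $b=|\lambda_2|$, $c=|\lambda_3|$, $g_n(x)=\frac{1-x^n}{1-x}=\sum_{q=0}^{n-1}x^q$,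 $w_1=|\lambda_1-\lambda_0^{m_0}|$, $w_2=|\lambda_2-\lambda_0^{m_0}\lambda_1^{m_1-1}|$, $w_3=|\lambda_3-\lambda_0^{m_0}\lambda_1^{m_1-1}\lambda_2^{m_2-1}|$, and $G=c^{N_3-2}+g_{N_3-2}(c)\,g_{m_2}(b)\,g_{m_1}(a)$. Columns: * $s^{\rm col}_0=w_3G+w_2\,g_{m_2-1}(b)\,g_{m_1}(a)+w_1\,g_{m_1-1}(a)$; * $s^{\rm col}_{m_1(m_2-j)}=w_2\,g_{j-1}(b)\,g_{m_1}(a)+w_1\,g_{m_1-1}(a)+b^{j-1}w_2\,G$ for $1\le j\le m_2-1$; * $s^{\rm col}_{m_1(m_2-j)-r-1}=w_1\big[a^r g_{m_1}(a)\,g_j(b)+g_r(a)\big]+b^ja^rw_1\,G$ for $0\le j\le m_2-1$, $0\le r\le m_1-2$. Rows, with $H=w_1\,g_{m_2}(b)\,g_{m_1-1}(a)+w_2\,g_{m_2-1}(b)+w_3$: * $s^{\rm row}_{N_1-1}=g_{N_3-1}(c)\,H$; * $s^{\rm row}_{N_1-1-m_1m_2+jm_1}=g_j(b)\big[w_1\,g_{m_1-1}(a)+w_2\big]+b^jg_{N_3-2}(c)\,H$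 for $1\le j\le m_2-1$; * $s^{\rm row}_{N_1-1-m_1m_2+r+jm_1}=a^rb^jg_{N_3-2}(c)\,H+a^rg_j(b)\big[w_2+w_1\,g_{m_1-1}(a)\big]+w_1\,g_r(a)$ for $0\le j\le m_2-1$, $1\le r\le m_1-1$. -/

import Mathlib

open scoped Matrix ENNReal

noncomputable section

namespace MGRIT

/-- Time-stepping operators and other operators on the spatial unknowns. -/
abbrev SpaceOp (Nx : ℕ) : Type := Matrix (Fin Nx) (Fin Nx) ℂ

/-- Space-time vectors with `n` time points and `Nx` spatial unknowns. -/
abbrev STVec (n Nx : ℕ) : Type := Fin n × Fin Nx → ℂ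

/-- Space-time matrices from `n'` to `n` time points. -/
abbrev STMat (n n' Nx : ℕ) : Type := Matrix (Fin n × Fin Nx) (Fin n' × Fin Nx) ℂ

/-- The F-points of a grid with `n` time points and coarsening factor `m`;
the C-points are the time points whose index is a multiple of `m`. -/
abbrev FPoint (n m : ℕ) : Type := {p : Fin n // ¬ m ∣ p.val}

/-- The block bidiagonal matrix `A` with identity blocks on the diagonal and
`-Φ` on the first block subdiagonal. -/
def systemMatrix {Nx : ℕ} (n : ℕ) (Φ : SpaceOp Nx) : STMat n n Nx :=
  Matrix.of fun p q =>
    if p.1.val = q.1.val then (1 : SpaceOp Nx) p.2 q.2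
    else if p.1.val = q.1.val + 1 then -(Φ p.2 q.2)
    else 0

/-- Ideal interpolation `P`: the block in row `p`, column `c` is `Φ ^ (p - c m)` for
`c m ≤ p < c m + m`, and zero otherwise. -/
def interpolation {Nx : ℕ} (n n' m : ℕ) (Φ : SpaceOp Nx) : STMat n n' Nx :=
  Matrix.of fun p c =>
    if c.1.val * m ≤ p.1.val ∧ p.1.val < c.1.val * m + m then
      (Φ ^ (p.1.val - c.1.val * m)) p.2 c.2
    else 0

/-- Ideal restriction `R`: the block in row `c`, column `p` is `Φ ^ (c m - p)` for
`c m - m < p ≤ c m`, and zero otherwise. -/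
def restriction {Nx : ℕ} (n n' m : ℕ) (Φ : SpaceOp Nx) : STMat n' n Nx :=
  Matrix.of fun c p =>
    if p.1.val ≤ c.1.val * m ∧ c.1.val * m < p.1.val + m then
      (Φ ^ (c.1.val * m - p.1.val)) c.2 p.2
    else 0

/-- Restriction by injection `R_I`, which picks out the C-points. -/
def injection (Nx n n' m : ℕ) : STMat n' n Nx :=
  Matrix.of fun c p =>
    if p.1.val = c.1.val * m then (1 : SpaceOp Nx) c.2 p.2 else 0

/-- The operator `S`, which embeds the F-points into all time points. -/
def fEmbedding (Nx n m : ℕ) : Matrix (Fin n × Fin Nx) (FPoint n m × Fin Nx) ℂ :=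
  Matrix.of fun p q => if p.1 = q.1.val then (1 : SpaceOp Nx) p.2 q.2 else 0

/-- `S (Sᵀ A S)⁻¹ Sᵀ`. -/
def fSolve {Nx : ℕ} (n m : ℕ) (Φ : SpaceOp Nx) : STMat n n Nx :=
  fEmbedding Nx n m *
    ((fEmbedding Nx n m)ᵀ * systemMatrix n Φ * fEmbedding Nx n m)⁻¹ *
    (fEmbedding Nx n m)ᵀ

/-! In what follows `m ℓ` is the coarsening factor from level `ℓ` to level `ℓ + 1`, `N ℓ` is the
number of time points on level `ℓ`, and `Φ ℓ` is the time-stepping operator on level `ℓ`. -/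

/-- The system matrix on level `ℓ`. -/
def Amat {Nx : ℕ} (N : ℕ → ℕ) (Φ : ℕ → SpaceOp Nx) (ℓ : ℕ) : STMat (N ℓ) (N ℓ) Nx :=
  systemMatrix (N ℓ) (Φ ℓ)

/-- Ideal interpolation from level `ℓ + 1` to level `ℓ`. -/
def Pmat {Nx : ℕ} (m N : ℕ → ℕ) (Φ : ℕ → SpaceOp Nx) (ℓ : ℕ) : STMat (N ℓ) (N (ℓ + 1)) Nx :=
  interpolation (N ℓ) (N (ℓ + 1)) (m ℓ) (Φ ℓ)

/-- Ideal restriction from level `ℓ` to level `ℓ + 1`. -/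
def Rmat {Nx : ℕ} (m N : ℕ → ℕ) (Φ : ℕ → SpaceOp Nx) (ℓ : ℕ) : STMat (N (ℓ + 1)) (N ℓ) Nx :=
  restriction (N ℓ) (N (ℓ + 1)) (m ℓ) (Φ ℓ)

/-- Restriction by injection from level `ℓ` to level `ℓ + 1`. -/
def RImat (Nx : ℕ) (m N : ℕ → ℕ) (ℓ : ℕ) : STMat (N (ℓ + 1)) (N ℓ) Nx :=
  injection Nx (N ℓ) (N (ℓ + 1)) (m ℓ)

/-- `S_ℓ (S_ℓᵀ A_ℓ S_ℓ)⁻¹ S_ℓᵀ`. -/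
def Fmat {Nx : ℕ} (m N : ℕ → ℕ) (Φ : ℕ → SpaceOp Nx) (ℓ : ℕ) : STMat (N ℓ) (N ℓ) Nx :=
  fSolve (N ℓ) (m ℓ) (Φ ℓ)

/-- F-relaxation on level `ℓ` for the system `A_ℓ x = b`. -/
def fRelax {Nx : ℕ} (m N : ℕ → ℕ) (Φ : ℕ → SpaceOp Nx) (ℓ : ℕ) (b x : STVec (N ℓ) Nx) :
    STVec (N ℓ) Nx :=
  x + Fmat m N Φ ℓ *ᵥ (b - Amat N Φ ℓ *ᵥ x)

/-- One MGRIT V-cycle with F-relaxation on level `ℓ`, with `c` coarser levels below it, applied to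
`A_ℓ x = b` with initial guess `x`: relax, restrict the residual, compute the correction by a
V-cycle with zero initial guess on the next level, interpolate the correction. The coarsest level
is solved exactly. -/
def vCycle {Nx : ℕ} (m N : ℕ → ℕ) (Φ : ℕ → SpaceOp Nx) :
    ℕ → (ℓ : ℕ) → STVec (N ℓ) Nx → STVec (N ℓ) Nx → STVec (N ℓ) Nx
  | 0, ℓ, b, _ => (Amat N Φ ℓ)⁻¹ *ᵥ b
  | c + 1, ℓ, b, x =>
      fRelax m N Φ ℓ b x +
        Pmat m N Φ ℓ *ᵥ
          vCycle m N Φ c (ℓ + 1)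
            (Rmat m N Φ ℓ *ᵥ (b - Amat N Φ ℓ *ᵥ fRelax m N Φ ℓ b x)) 0

/-- The iterates of four-level MGRIT V-cycles with F-relaxation for `A_0 u = g`. -/
def iterate {Nx : ℕ} (m N : ℕ → ℕ) (Φ : ℕ → SpaceOp Nx) (g u₀ : STVec (N 0) Nx) (i : ℕ) :
    STVec (N 0) Nx :=
  (fun u => vCycle m N Φ 3 0 g u)^[i] u₀

/-- The fine-grid residual of the `i`-th iterate. -/
def residual {Nx : ℕ} (m N : ℕ → ℕ) (Φ : ℕ → SpaceOp Nx) (g u₀ : STVec (N 0) Nx) (i : ℕ) :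
    STVec (N 0) Nx :=
  g - Amat N Φ 0 *ᵥ iterate m N Φ g u₀ i

/-- The Euclidean norm of a space-time vector. -/
def norm2 {n Nx : ℕ} (v : STVec n Nx) : ℝ := √(∑ p, ‖v p‖ ^ 2)

/-- The initial residual vanishes at all F-points of the fine grid, as it does for an initial guess
to which F-relaxation has been applied. -/
def FRelaxedStart {Nx : ℕ} (m N : ℕ → ℕ) (Φ : ℕ → SpaceOp Nx) (g u₀ : STVec (N 0) Nx) : Prop :=
  ∀ (p : FPoint (N 0) (m 0)) (a : Fin Nx), residual m N Φ g u₀ 0 (p.val, a) = 0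

/-- The worst-case convergence factor of four-level MGRIT V-cycles with F-relaxation: the supremum
of `‖r_{i+1}‖₂ / ‖r_i‖₂` over all right-hand sides, initial guesses and iterations, where the very
first iteration counts only if the initial residual vanishes at the F-points. The quotient is taken
in `[0, ∞]`, where `0 / 0 = 0` and `x / 0 = ∞` for `x > 0`. -/
def convergenceFactor {Nx : ℕ} (m N : ℕ → ℕ) (Φ : ℕ → SpaceOp Nx) : ℝ≥0∞ :=
  ⨆ (g : STVec (N 0) Nx) (u₀ : STVec (N 0) Nx) (i : ℕ)
    (_ : 1 ≤ i ∨ FRelaxedStart m N Φ g u₀),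
    ENNReal.ofReal (norm2 (residual m N Φ g u₀ (i + 1))) /
      ENNReal.ofReal (norm2 (residual m N Φ g u₀ i))

/-- The error propagator of four-level MGRIT V-cycles with F-relaxation on level `0`. -/
def errorPropagator {Nx : ℕ} (m N : ℕ → ℕ) (Φ : ℕ → SpaceOp Nx) : STMat (N 0) (N 0) Nx :=
  Pmat m N Φ 0 * RImat Nx m N 0
    - (Pmat m N Φ 0 * Pmat m N Φ 1 * Pmat m N Φ 2) * (Amat N Φ 3)⁻¹ *
        (Rmat m N Φ 2 * Rmat m N Φ 1 * Rmat m N Φ 0) *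
        Amat N Φ 0 * Pmat m N Φ 0 * RImat Nx m N 0
    - (Pmat m N Φ 0 * Fmat m N Φ 1 * Rmat m N Φ 0 *
          Amat N Φ 0 * Pmat m N Φ 0 * RImat Nx m N 0
        + (Pmat m N Φ 0 * Pmat m N Φ 1) * Fmat m N Φ 2 * (Rmat m N Φ 1 * Rmat m N Φ 0) *
          Amat N Φ 0 * Pmat m N Φ 0 * RImat Nx m N 0)

/-- The error propagator on level `1`, that is, on the C-points of level `0`. -/
def coarseErrorPropagator {Nx : ℕ} (m N : ℕ → ℕ) (Φ : ℕ → SpaceOp Nx) : STMat (N 1) (N 1) Nx :=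
  RImat Nx m N 0 * errorPropagator m N Φ * Pmat m N Φ 0

/-- The level-`1` error propagator in the common eigenbasis: the time-stepping operators are replaced
by the diagonal matrices of their eigenvalues. -/
def diagonalizedPropagator {Nx : ℕ} (m N : ℕ → ℕ) (lam : ℕ → Fin Nx → ℂ) :
    STMat (N 1) (N 1) Nx :=
  coarseErrorPropagator m N fun ℓ => Matrix.diagonal (lam ℓ)

/-- Absolute column sum. -/
def absColSum {ι κ : Type*} [Fintype ι] (M : Matrix ι κ ℂ) (q : κ) : ℝ := ∑ p, ‖M p q‖

/-- Absolute row sum. -/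
def absRowSum {ι κ : Type*} [Fintype κ] (M : Matrix ι κ ℂ) (p : ι) : ℝ := ∑ q, ‖M p q‖

/-- The matrix norm `‖M‖₁` (maximal absolute column sum). -/
def matNorm1 {ι κ : Type*} [Fintype ι] (M : Matrix ι κ ℂ) : ℝ := ⨆ q, absColSum M q

/-- The matrix norm `‖M‖_∞` (maximal absolute row sum). -/
def matNormInf {ι κ : Type*} [Fintype κ] (M : Matrix ι κ ℂ) : ℝ := ⨆ p, absRowSum M p

/-! The explicit column and row sums for one spatial mode. The numbers `l0 l1 l2 l3` are the
eigenvalues of this mode on the levels `0, 1, 2, 3`, the numbers `m0 m1 m2` are the coarsening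
factors, and `N3` is the number of time points on the coarsest level. -/

/-- `(1 - a ^ n) / (1 - a)`. -/
def geo (a : ℝ) (n : ℕ) : ℝ := (1 - a ^ n) / (1 - a)

/-- `|λ₁ - λ₀^{m₀}|`. -/
def w1 (m0 : ℕ) (l0 l1 : ℂ) : ℝ := ‖l1 - l0 ^ m0‖

/-- `|λ₂ - λ₀^{m₀} λ₁^{m₁-1}|`. -/
def w2 (m0 m1 : ℕ) (l0 l1 l2 : ℂ) : ℝ := ‖l2 - l0 ^ m0 * l1 ^ (m1 - 1)‖

/-- `|λ₃ - λ₀^{m₀} λ₁^{m₁-1} λ₂^{m₂-1}|`. -/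
def w3 (m0 m1 m2 : ℕ) (l0 l1 l2 l3 : ℂ) : ℝ :=
  ‖l3 - l0 ^ m0 * l1 ^ (m1 - 1) * l2 ^ (m2 - 1)‖

/-- Column sum for the first C-point on level `1`, that is, for the column `0`. -/
def colFirst (m0 m1 m2 N3 : ℕ) (l0 l1 l2 l3 : ℂ) : ℝ :=
  ‖l3‖ ^ (N3 - 2) * w3 m0 m1 m2 l0 l1 l2 l3
    + w3 m0 m1 m2 l0 l1 l2 l3 * geo ‖l3‖ (N3 - 2) * geo ‖l2‖ m2 * geo ‖l1‖ m1
    + w2 m0 m1 l0 l1 l2 * geo ‖l2‖ (m2 - 1) * geo ‖l1‖ m1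
    + w1 m0 l0 l1 * geo ‖l1‖ (m1 - 1)

/-- Column sum for the interior C-points of the first CF-interval: column `m₁ (m₂ - j)`,
for `j = 1, …, m₂ - 1`. -/
def colC (m0 m1 m2 N3 : ℕ) (l0 l1 l2 l3 : ℂ) (j : ℕ) : ℝ :=
  w2 m0 m1 l0 l1 l2 * (∑ p ∈ Finset.range (j - 1), ‖l2‖ ^ p) * geo ‖l1‖ m1
    + w1 m0 l0 l1 * geo ‖l1‖ (m1 - 1)
    + ‖l2‖ ^ (j - 1) * w2 m0 m1 l0 l1 l2 *
        (‖l3‖ ^ (N3 - 2) + geo ‖l3‖ (N3 - 2) * geo ‖l2‖ m2 * geo ‖l1‖ m1)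

/-- Column sum for the F-points of the first CF-interval: column `m₁ (m₂ - j) - r - 1`,
for `j = 0, …, m₂ - 1` and `r = 0, …, m₁ - 2`. -/
def colF (m0 m1 m2 N3 : ℕ) (l0 l1 l2 l3 : ℂ) (j r : ℕ) : ℝ :=
  w1 m0 l0 l1 *
      (‖l1‖ ^ r * (∑ q ∈ Finset.range m1, ‖l1‖ ^ q) * (∑ p ∈ Finset.range j, ‖l2‖ ^ p)
        + ∑ q ∈ Finset.range r, ‖l1‖ ^ q)
    + ‖l2‖ ^ j * ‖l1‖ ^ r * w1 m0 l0 l1 *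
        (‖l3‖ ^ (N3 - 2) + geo ‖l3‖ (N3 - 2) * geo ‖l2‖ m2 * geo ‖l1‖ m1)

/-- Row sum for the last C-point on level `1`, that is, for the row `N₁ - 1`. -/
def rowLast (m0 m1 m2 N3 : ℕ) (l0 l1 l2 l3 : ℂ) : ℝ :=
  geo ‖l3‖ (N3 - 1) *
    (w1 m0 l0 l1 * geo ‖l2‖ m2 * geo ‖l1‖ (m1 - 1)
      + w2 m0 m1 l0 l1 l2 * geo ‖l2‖ (m2 - 1)
      + w3 m0 m1 m2 l0 l1 l2 l3)

/-- Row sum for the interior C-points of the last FC-interval: row `N₁ - 1 - m₁ m₂ + j m₁`,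
for `j = 1, …, m₂ - 1`. -/
def rowC (m0 m1 m2 N3 : ℕ) (l0 l1 l2 l3 : ℂ) (j : ℕ) : ℝ :=
  geo ‖l2‖ j * (w1 m0 l0 l1 * geo ‖l1‖ (m1 - 1) + w2 m0 m1 l0 l1 l2)
    + ‖l2‖ ^ j * geo ‖l3‖ (N3 - 2) *
        (w1 m0 l0 l1 * geo ‖l2‖ m2 * geo ‖l1‖ (m1 - 1)
          + w2 m0 m1 l0 l1 l2 * geo ‖l2‖ (m2 - 1)
          + w3 m0 m1 m2 l0 l1 l2 l3)

/-- Row sum for the F-points of the last FC-interval: row `N₁ - 1 - m₁ m₂ + r + j m₁`,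
for `j = 0, …, m₂ - 1` and `r = 1, …, m₁ - 1`. -/
def rowF (m0 m1 m2 N3 : ℕ) (l0 l1 l2 l3 : ℂ) (j r : ℕ) : ℝ :=
  ‖l1‖ ^ r * ‖l2‖ ^ j * geo ‖l3‖ (N3 - 2) *
      (w2 m0 m1 l0 l1 l2 * geo ‖l2‖ (m2 - 1) + w3 m0 m1 m2 l0 l1 l2 l3)
    + ‖l1‖ ^ r * (∑ q ∈ Finset.range j, ‖l2‖ ^ q) *
        (w2 m0 m1 l0 l1 l2 + w1 m0 l0 l1 * geo ‖l1‖ (m1 - 1))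
    + ‖l1‖ ^ r * ‖l2‖ ^ j * w1 m0 l0 l1 * geo ‖l3‖ (N3 - 2) * geo ‖l2‖ m2 * geo ‖l1‖ (m1 - 1)
    + w1 m0 l0 l1 * geo ‖l1‖ r

/-- The explicit sum for column `d`, `0 ≤ d < m₁ m₂`. -/
def sCol (m0 m1 m2 N3 : ℕ) (l0 l1 l2 l3 : ℂ) (d : ℕ) : ℝ :=
  if d = 0 then colFirst m0 m1 m2 N3 l0 l1 l2 l3
  else if m1 ∣ d then colC m0 m1 m2 N3 l0 l1 l2 l3 (m2 - d / m1)
  else colF m0 m1 m2 N3 l0 l1 l2 l3 (m2 - 1 - d / m1) (m1 - 1 - d % m1)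

/-- The explicit sum for row `N₁ - 1 - m₁ m₂ + t`, `1 ≤ t ≤ m₁ m₂`. -/
def sRow (m0 m1 m2 N3 : ℕ) (l0 l1 l2 l3 : ℂ) (t : ℕ) : ℝ :=
  if t = m1 * m2 then rowLast m0 m1 m2 N3 l0 l1 l2 l3
  else if m1 ∣ t then rowC m0 m1 m2 N3 l0 l1 l2 l3 (t / m1)
  else rowF m0 m1 m2 N3 l0 l1 l2 l3 (t / m1) (t % m1)

/-! The indices in `sCol` and `sRow` enumerate the cases as described. -/

theorem sCol_zero (m0 m1 m2 N3 : ℕ) (l0 l1 l2 l3 : ℂ) :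
    sCol m0 m1 m2 N3 l0 l1 l2 l3 0 = colFirst m0 m1 m2 N3 l0 l1 l2 l3 := by
  simp [sCol]

theorem sCol_C (m0 m1 m2 N3 : ℕ) (l0 l1 l2 l3 : ℂ) (hm1 : 1 ≤ m1) (j : ℕ)
    (hj : 1 ≤ j) (hj' : j ≤ m2 - 1) :
    sCol m0 m1 m2 N3 l0 l1 l2 l3 (m1 * (m2 - j)) = colC m0 m1 m2 N3 l0 l1 l2 l3 j := by
  have h0 : m1 * (m2 - j) ≠ 0 := Nat.mul_ne_zero (by omega) (by omega)
  have h1 : m1 * (m2 - j) / m1 = m2 - j := Nat.mul_div_cancel_left _ hm1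
  have h2 : m2 - (m2 - j) = j := by omega
  rw [sCol, if_neg h0, if_pos (Dvd.intro _ rfl), h1, h2]

theorem sCol_F (m0 m1 m2 N3 : ℕ) (l0 l1 l2 l3 : ℂ) (j r : ℕ)
    (hj : j < m2) (hr : r + 2 ≤ m1) :
    sCol m0 m1 m2 N3 l0 l1 l2 l3 (m1 * (m2 - j) - r - 1)
      = colF m0 m1 m2 N3 l0 l1 l2 l3 j r := by
  obtain ⟨e, rfl⟩ : ∃ e, m2 = e + 1 + j := ⟨m2 - 1 - j, by omega⟩
  have h : m1 * (e + 1 + j - j) - r - 1 = (m1 - 1 - r) + m1 * e := by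
    have : m1 * (e + 1 + j - j) = m1 * e + m1 := by
      rw [Nat.add_sub_cancel, Nat.mul_add, Nat.mul_one]
    omega
  have hmod : ((m1 - 1 - r) + m1 * e) % m1 = m1 - 1 - r := by
    rw [Nat.add_mul_mod_self_left, Nat.mod_eq_of_lt (by omega)]
  have hdiv : ((m1 - 1 - r) + m1 * e) / m1 = e := by
    rw [Nat.add_mul_div_left _ _ (by omega), Nat.div_eq_of_lt (by omega), Nat.zero_add]
  have h2 : ¬ m1 ∣ (m1 - 1 - r) + m1 * e := by
    rw [Nat.dvd_iff_mod_eq_zero, hmod]; omega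
  rw [h, sCol, if_neg (by omega), if_neg h2, hmod, hdiv]
  congr 1 <;> omega

theorem sRow_last (m0 m1 m2 N3 : ℕ) (l0 l1 l2 l3 : ℂ) :
    sRow m0 m1 m2 N3 l0 l1 l2 l3 (m1 * m2) = rowLast m0 m1 m2 N3 l0 l1 l2 l3 := by
  simp [sRow]

theorem sRow_C (m0 m1 m2 N3 : ℕ) (l0 l1 l2 l3 : ℂ) (hm1 : 1 ≤ m1) (j : ℕ)
    (hj : 1 ≤ j) (hj' : j ≤ m2 - 1) :
    sRow m0 m1 m2 N3 l0 l1 l2 l3 (j * m1) = rowC m0 m1 m2 N3 l0 l1 l2 l3 j := by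
  have h0 : j * m1 ≠ m1 * m2 := by
    rw [Nat.mul_comm j m1]
    intro h
    have := Nat.eq_of_mul_eq_mul_left hm1 h
    omega
  rw [sRow, if_neg h0, if_pos (Dvd.intro_left _ rfl), Nat.mul_div_cancel _ hm1]

theorem sRow_F (m0 m1 m2 N3 : ℕ) (l0 l1 l2 l3 : ℂ) (j r : ℕ)
    (hr : 1 ≤ r) (hr' : r ≤ m1 - 1) :
    sRow m0 m1 m2 N3 l0 l1 l2 l3 (r + j * m1) = rowF m0 m1 m2 N3 l0 l1 l2 l3 j r := by
  have hmod : (r + j * m1) % m1 = r := by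
    rw [Nat.add_mul_mod_self_right, Nat.mod_eq_of_lt (by omega)]
  have hdiv : (r + j * m1) / m1 = j := by
    rw [Nat.add_mul_div_right _ _ (by omega), Nat.div_eq_of_lt (by omega), Nat.zero_add]
  have h2 : ¬ m1 ∣ r + j * m1 := by
    rw [Nat.dvd_iff_mod_eq_zero, hmod]; omega
  have h1 : r + j * m1 ≠ m1 * m2 := fun h => h2 (h ▸ Dvd.intro _ rfl)
  rw [sRow, if_neg h1, if_neg h2, hmod, hdiv]

end MGRIT

end

/-!
The blocks of every matrix of the method do not depend on the number of time points, so each matrix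
is the leading part of a kernel on `ℕ × ℕ`. With zero initial guess, a V-cycle on level `ℓ` is the
matrix `Q + P C R`, where `C` is the V-cycle on level `ℓ + 1`; on kernels this is a recursion
through unit lower triangular kernels. Eliminating the F-points of level `0` turns `A₀` into the
bidiagonal matrix `A'` with blocks `1` and `-Φ₀ ^ m₀`, so that on level `1` the error is propagated
by `1 - C A'` and the residual, supported on the C-points, by `1 - A' C`. The kernels are invariant
under reflection of time combined with transposition. In the common eigenbasis the residual
propagator is therefore the reflected transpose of the error propagator, and the Schur test bounds
the convergence factor.

The kernel of `1 - C A'` is invariant under a shift by `m₁ m₂` time points and strictly lower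
triangular, so the largest column and row sums occur in the first and in the last block of `m₁ m₂`
points. Passing to a coarser level replaces the propagated operator `μ` by `l ^ (m - 1) * μ`, and
at each entry at most one of the F-point and the coarse-grid contributions is nonzero. The absolute
sums thus obey a recursion over the levels, and each level contributes geometric sums.
-/

noncomputable section

open scoped Kronecker

namespace MGRIT

section BlockIndices

variable {m : ℕ}

theorem ceilDiv_of_add_eq_mul {q j C : ℕ} (hj : j < m) (h : q + j = m * C) : q ⌈/⌉ m = C := by
  rw [Nat.ceilDiv_eq_add_pred_div, show q + m - 1 = m - 1 - j + m * C by omega,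
    Nat.add_mul_div_left _ _ (by omega), Nat.div_eq_of_lt (by omega), Nat.zero_add]

theorem exists_add_eq_mul (hm : 0 < m) (q : ℕ) : ∃ C j, j < m ∧ q + j = m * C := by
  have hlt := Nat.mod_lt (q + (m - 1)) hm
  have hdiv := Nat.div_add_mod (q + (m - 1)) m
  exact ⟨(q + (m - 1)) / m, m - 1 - (q + (m - 1)) % m, by omega, by omega⟩

theorem exists_eq_mul_add (hm : 0 < m) (p : ℕ) : ∃ P i, i < m ∧ p = m * P + i :=
  ⟨p / m, p % m, Nat.mod_lt p hm, (Nat.div_add_mod p m).symm⟩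

theorem mul_add_div_of_lt {i : ℕ} (hi : i < m) (P : ℕ) : (m * P + i) / m = P := by
  rw [Nat.mul_add_div (by omega), Nat.div_eq_of_lt hi, Nat.add_zero]

theorem mul_add_mod_of_lt {i : ℕ} (hi : i < m) (P : ℕ) : (m * P + i) % m = i := by
  rw [Nat.mul_add_mod, Nat.mod_eq_of_lt hi]

end BlockIndices

section Kernels

variable {α β : Type*} [Ring α] [Ring β]

/-- The kernel of the inverse of the block bidiagonal matrix with blocks `1` and `-l`. All matrices
in time are represented by their kernels on `ℕ × ℕ`, of which they are the leading parts. -/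
def invKernel (l : α) (p q : ℕ) : α := if q ≤ p then l ^ (p - q) else 0

/-- The kernel of the F-point solve `S (Sᵀ A S)⁻¹ Sᵀ` with coarsening factor `m`: the values of
`invKernel l` at pairs `q ≤ p` that are not separated by a C-point `c` with `q ≤ c ≤ p`. -/
def relaxKernel (m : ℕ) (l : α) (p q : ℕ) : α :=
  if q ≤ p ∧ p / m < q ⌈/⌉ m then l ^ (p - q) else 0

/-- The kernel of `Q + P C R`, an F-point solve combined with the coarse-grid correction given by
the matrix `C` with kernel `κ`. -/
def cycleKernel (m : ℕ) (l : α) (κ : ℕ → ℕ → α) (p q : ℕ) : α :=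
  relaxKernel m l p q + l ^ (p % m) * κ (p / m) (q ⌈/⌉ m) * l ^ (m * (q ⌈/⌉ m) - q)

/-- The kernel of the error propagator `1 - C A` when `C` has kernel `κ` and `A` is block bidiagonal
with blocks `1` and `-μ`. -/
def errKernel (μ : α) (κ : ℕ → ℕ → α) (p q : ℕ) : α :=
  (if p = q then 1 else 0) - κ p q + κ p (q + 1) * μ

/-- The kernel of the residual propagator `1 - A C` when `C` has kernel `κ` and `A` is block
bidiagonal with blocks `1` and `-μ`. -/
def resKernel (μ : α) (κ : ℕ → ℕ → α) (p q : ℕ) : α :=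
  (if p = q then 1 else 0) - κ p q + if p = 0 then 0 else μ * κ (p - 1) q

/-- The kernel of a V-cycle with zero initial guess on level `ℓ` with `c` coarser levels below
it. -/
def vCycleKernel (m : ℕ → ℕ) (l : ℕ → α) : ℕ → ℕ → ℕ → ℕ → α
  | 0, ℓ => invKernel (l ℓ)
  | c + 1, ℓ => cycleKernel (m ℓ) (l ℓ) (vCycleKernel m l c (ℓ + 1))

/-- A kernel that is lower triangular with ones on the diagonal. -/
structure UnitLower (κ : ℕ → ℕ → α) : Prop where
  apply_self : ∀ p, κ p p = 1
  eq_zero_of_lt : ∀ {p q}, p < q → κ p q = 0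

theorem invKernel_of_lt (l : α) {p q : ℕ} (h : p < q) : invKernel l p q = 0 :=
  if_neg (not_le.2 h)

theorem unitLower_invKernel (l : α) : UnitLower (invKernel l) where
  apply_self p := by simp [invKernel]
  eq_zero_of_lt := invKernel_of_lt l

theorem relaxKernel_apply {m i j P q C : ℕ} (hi : i < m) (hj : j < m) (h : q + j = m * C) (l : α) :
    relaxKernel m l (m * P + i) q = if C = P + 1 ∧ m ≤ i + j then l ^ (i + j - m) else 0 := by
  rw [relaxKernel, ceilDiv_of_add_eq_mul hj h, mul_add_div_of_lt hi]
  have hcond : (q ≤ m * P + i ∧ P < C) ↔ (C = P + 1 ∧ m ≤ i + j) := by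
    constructor
    · rintro ⟨hq, hPC⟩
      have hC : C < P + 2 := by
        refine Nat.lt_of_mul_lt_mul_left (a := m) ?_
        rw [Nat.mul_add]; omega
      obtain rfl : C = P + 1 := by omega
      rw [Nat.mul_succ] at h
      exact ⟨rfl, by omega⟩
    · rintro ⟨rfl, hij⟩
      rw [Nat.mul_succ] at h
      exact ⟨by omega, P.lt_succ_self⟩
  simp only [hcond]
  split_ifs with hC
  · obtain ⟨rfl, hij⟩ := hC
    rw [Nat.mul_succ] at h
    congr 1
    omega
  · rfl

theorem cycleKernel_apply {m i j P q C : ℕ} (hi : i < m) (hj : j < m) (h : q + j = m * C) (l : α)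
    (κ : ℕ → ℕ → α) :
    cycleKernel m l κ (m * P + i) q =
      (if C = P + 1 ∧ m ≤ i + j then l ^ (i + j - m) else 0) + l ^ i * κ P C * l ^ j := by
  rw [cycleKernel, relaxKernel_apply hi hj h, ceilDiv_of_add_eq_mul hj h, mul_add_div_of_lt hi,
    mul_add_mod_of_lt hi, ← h, Nat.add_sub_cancel_left]

theorem cycleKernel_mul_right {m i : ℕ} (hi : i < m) (l : α) (κ : ℕ → ℕ → α) (P C : ℕ) :
    cycleKernel m l κ (m * P + i) (m * C) = l ^ i * κ P C := by
  rw [cycleKernel_apply hi (by omega) (add_zero (m * C)), if_neg (by omega), zero_add, pow_zero,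
    mul_one]

theorem cycleKernel_mul_add_one_right {m i : ℕ} (hi : i < m) (l : α) (κ : ℕ → ℕ → α) (P C : ℕ) :
    cycleKernel m l κ (m * P + i) (m * C + 1) =
      (if C = P ∧ 0 < i then l ^ (i - 1) else 0) + l ^ i * κ P (C + 1) * l ^ (m - 1) := by
  have h : m * C + 1 + (m - 1) = m * (C + 1) := by rw [Nat.mul_succ]; omega
  have hcond : (C + 1 = P + 1 ∧ m ≤ i + (m - 1)) ↔ (C = P ∧ 0 < i) := by omega
  rw [cycleKernel_apply hi (by omega) h, show i + (m - 1) - m = i - 1 by omega]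
  simp only [hcond]

theorem UnitLower.cycleKernel {m : ℕ} (hm : 0 < m) (l : α) {κ : ℕ → ℕ → α} (hκ : UnitLower κ) :
    UnitLower (cycleKernel m l κ) where
  apply_self p := by
    obtain ⟨P, i, hi, rfl⟩ := exists_eq_mul_add hm p
    rcases Nat.eq_zero_or_pos i with rfl | hi0
    · simpa [hκ.apply_self] using cycleKernel_apply hm hm (add_zero (m * P)) l κ (P := P)
    · rw [cycleKernel_apply hi (j := m - i) (C := P + 1) (by omega)
        (by rw [Nat.mul_succ]; omega), hκ.eq_zero_of_lt P.lt_succ_self,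
        if_pos ⟨rfl, by omega⟩]
      simp [Nat.add_sub_cancel' hi.le]
  eq_zero_of_lt {p q} hpq := by
    obtain ⟨P, i, hi, rfl⟩ := exists_eq_mul_add hm p
    obtain ⟨C, j, hj, hq⟩ := exists_add_eq_mul hm q
    have hPC : P < C := Nat.lt_of_mul_lt_mul_left (a := m) (by omega)
    rw [cycleKernel_apply hi hj hq, hκ.eq_zero_of_lt hPC, if_neg]
    · simp
    · rintro ⟨rfl, hij⟩
      rw [Nat.mul_succ] at hq
      omega

theorem cycleKernel_invKernel {m : ℕ} (hm : 0 < m) (l : α) :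
    cycleKernel m l (invKernel (l ^ m)) = invKernel l := by
  funext p q
  obtain ⟨P, i, hi, rfl⟩ := exists_eq_mul_add hm p
  obtain ⟨C, j, hj, hq⟩ := exists_add_eq_mul hm q
  rw [cycleKernel_apply hi hj hq, invKernel, invKernel]
  rcases le_or_gt C P with hCP | hPC
  · obtain ⟨d, rfl⟩ := Nat.exists_eq_add_of_le hCP
    rw [if_neg (by omega), if_pos hCP, if_pos (by rw [Nat.mul_add]; omega), zero_add,
      Nat.add_sub_cancel_left, ← pow_mul, ← pow_add, ← pow_add]
    congr 1
    rw [Nat.mul_add]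
    omega
  · rw [if_neg (not_le.2 hPC), mul_zero, zero_mul, add_zero]
    have hrelax := relaxKernel_apply (P := P) hi hj hq l
    rw [relaxKernel, ceilDiv_of_add_eq_mul hj hq, mul_add_div_of_lt hi] at hrelax
    simpa only [hPC, and_true] using hrelax.symm

theorem errKernel_of_le {κ : ℕ → ℕ → α} (hκ : UnitLower κ) (μ : α) {p q : ℕ} (h : p ≤ q) :
    errKernel μ κ p q = 0 := by
  rw [errKernel, hκ.eq_zero_of_lt (Nat.lt_succ_of_le h)]
  rcases h.eq_or_lt with rfl | hlt
  · simp [hκ.apply_self]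
  · simp [hκ.eq_zero_of_lt hlt, hlt.ne]

theorem errKernel_invKernel (μ l : α) (p q : ℕ) :
    errKernel μ (invKernel l) p q = invKernel l p (q + 1) * (μ - l) := by
  rcases lt_trichotomy p q with hpq | rfl | hpq
  · simp [errKernel, invKernel_of_lt l hpq, invKernel_of_lt l (Nat.lt_succ_of_lt hpq), hpq.ne]
  · simp [errKernel, invKernel]
  · obtain ⟨d, rfl⟩ := Nat.exists_eq_add_of_le hpq
    have h : q + 1 + d - q = d + 1 := by omega
    simp only [errKernel, invKernel, if_neg hpq.ne', if_pos hpq.le, if_pos (Nat.succ_le_of_lt hpq),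
      h, Nat.add_sub_cancel_left, pow_succ, mul_sub]
    abel

theorem errKernel_cycleKernel_of_lt {m j C q : ℕ} (hj : j + 1 < m) (h : q + 1 + j = m * C)
    (μ l : α) (κ : ℕ → ℕ → α) (p : ℕ) :
    errKernel μ (cycleKernel m l κ) p q = cycleKernel m l κ p (q + 1) * (μ - l) := by
  obtain ⟨P, i, hi, rfl⟩ := exists_eq_mul_add (Nat.zero_lt_of_lt hj) p
  rw [errKernel, cycleKernel_apply hi hj (by omega : q + (j + 1) = m * C),
    cycleKernel_apply hi (by omega : j < m) h]
  suffices hdiag : (if C = P + 1 ∧ m ≤ i + (j + 1) then l ^ (i + (j + 1) - m) else 0) =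
      (if m * P + i = q then 1 else 0) +
        (if C = P + 1 ∧ m ≤ i + j then l ^ (i + j - m) else 0) * l by
    rw [hdiag, pow_succ]
    noncomm_ring
  by_cases hC : C = P + 1
  · subst hC
    rw [Nat.mul_succ] at h
    rcases lt_trichotomy m (i + j + 1) with hlt | heq | hgt
    · rw [if_pos ⟨rfl, by omega⟩, if_neg (by omega), if_pos ⟨rfl, by omega⟩, zero_add, ← pow_succ]
      congr 1
      omega
    · rw [if_pos ⟨rfl, by omega⟩, if_pos (by omega), if_neg (by omega)]
      simp [heq, add_assoc]
    · rw [if_neg (by omega), if_neg (by omega), if_neg (by omega)]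
      simp
  · have hne : m * P + i ≠ q := by
      rintro rfl
      refine hC (le_antisymm ?_ ?_) <;>
        refine Nat.lt_succ_iff.1 (Nat.lt_of_mul_lt_mul_left (a := m) ?_) <;>
        simp only [Nat.mul_succ] <;> omega
    simp [hC, hne]

theorem errKernel_cycleKernel_mul {m i : ℕ} (hi : i < m) (μ l : α) (κ : ℕ → ℕ → α) (P C : ℕ) :
    errKernel μ (cycleKernel m l κ) (m * P + i) (m * C) =
      (if C = P ∧ 0 < i then l ^ (i - 1) * (μ - l) else 0) +
        l ^ i * errKernel (l ^ (m - 1) * μ) κ P C := by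
  have hdiag : (if m * P + i = m * C then (1 : α) else 0) =
      (if P = C then l ^ i else 0) - if C = P ∧ 0 < i then l ^ (i - 1) * l else 0 := by
    rcases Nat.eq_zero_or_pos i with rfl | hi0
    · simp [Nat.mul_right_inj hi.ne']
    · have hne : m * P + i ≠ m * C := fun h => by
        have hmod := mul_add_mod_of_lt hi P
        rw [h, Nat.mul_mod_right] at hmod
        omega
      simp [hne, hi0, eq_comm (a := C), ← pow_succ, Nat.sub_add_cancel hi0]
  have hsplit : (if P = C then l ^ i else 0) = l ^ i * if P = C then 1 else 0 := by simp
  rw [errKernel, errKernel, cycleKernel_mul_right hi, cycleKernel_mul_add_one_right hi, hdiag,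
    hsplit]
  split_ifs <;> noncomm_ring

theorem invKernel_add_right (l : α) (p q s : ℕ) :
    invKernel l (p + s) (q + s) = invKernel l p q := by
  simp [invKernel, Nat.add_sub_add_right]

theorem cycleKernel_add_right {m : ℕ} (hm : 0 < m) (l : α) {κ : ℕ → ℕ → α} {s : ℕ}
    (hκ : ∀ p q, κ (p + s) (q + s) = κ p q) (p q : ℕ) :
    cycleKernel m l κ (p + m * s) (q + m * s) = cycleKernel m l κ p q := by
  obtain ⟨P, i, hi, rfl⟩ := exists_eq_mul_add hm p
  obtain ⟨C, j, hj, hq⟩ := exists_add_eq_mul hm q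
  have hp : m * P + i + m * s = m * (P + s) + i := by ring
  rw [hp, cycleKernel_apply hi hj hq, cycleKernel_apply hi hj (C := C + s) (by linarith), hκ]
  simp [add_right_comm P s 1]

theorem errKernel_add_right {κ : ℕ → ℕ → α} {s : ℕ} (hκ : ∀ p q, κ (p + s) (q + s) = κ p q)
    (μ : α) (p q : ℕ) : errKernel μ κ (p + s) (q + s) = errKernel μ κ p q := by
  rw [errKernel, errKernel, hκ, add_right_comm q s 1, hκ]
  simp

theorem map_invKernel (f : α →+* β) (l : α) (p q : ℕ) :
    f (invKernel l p q) = invKernel (f l) p q := by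
  simp [invKernel, apply_ite f]

theorem map_cycleKernel (f : α →+* β) (m : ℕ) (l : α) (κ : ℕ → ℕ → α) (p q : ℕ) :
    f (cycleKernel m l κ p q) = cycleKernel m (f l) (fun p q => f (κ p q)) p q := by
  simp [cycleKernel, relaxKernel, apply_ite f]

theorem map_errKernel (f : α →+* β) (μ : α) (κ : ℕ → ℕ → α) (p q : ℕ) :
    f (errKernel μ κ p q) = errKernel (f μ) (fun p q => f (κ p q)) p q := by
  simp [errKernel, apply_ite f]

theorem map_resKernel (f : α →+* β) (μ : α) (κ : ℕ → ℕ → α) (p q : ℕ) :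
    f (resKernel μ κ p q) = resKernel (f μ) (fun p q => f (κ p q)) p q := by
  simp [resKernel, apply_ite f]

theorem map_vCycleKernel (f : α →+* β) (m : ℕ → ℕ) {l : ℕ → α} {l' : ℕ → β} (c : ℕ) {ℓ : ℕ}
    (h : ∀ i, ℓ ≤ i → i ≤ ℓ + c → l' i = f (l i)) :
    vCycleKernel m l' c ℓ = fun p q => f (vCycleKernel m l c ℓ p q) := by
  induction c generalizing ℓ with
  | zero => funext p q; simp only [vCycleKernel, map_invKernel, h ℓ le_rfl le_rfl]
  | succ c ih =>
    funext p q
    rw [vCycleKernel, vCycleKernel, map_cycleKernel, h ℓ le_rfl (Nat.le_add_right _ _),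
      ih fun i h₁ h₂ => h i (by omega) (by omega)]

theorem unitLower_vCycleKernel {m : ℕ → ℕ} (l : ℕ → α) (c : ℕ) {ℓ : ℕ}
    (hm : ∀ i, ℓ ≤ i → i < ℓ + c → 0 < m i) : UnitLower (vCycleKernel m l c ℓ) := by
  induction c generalizing ℓ with
  | zero => exact unitLower_invKernel (l ℓ)
  | succ c ih =>
    exact (ih fun i h₁ h₂ => hm i (by omega) (by omega)).cycleKernel
      (hm ℓ le_rfl (by omega)) (l ℓ)

end Kernels

section Persymmetry

variable {α : Type*} [CommRing α]

theorem invKernel_sub_sub (l : α) {K p q : ℕ} (hp : p ≤ K) (hq : q ≤ K) :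
    invKernel l (K - q) (K - p) = invKernel l p q := by
  rw [invKernel, invKernel, show K - q - (K - p) = p - q by omega]
  exact if_congr (by omega) rfl rfl

theorem cycleKernel_sub_sub {m : ℕ} (hm : 0 < m) (l : α) {κ : ℕ → ℕ → α} {K : ℕ}
    (hκ : ∀ p ≤ K, ∀ q ≤ K, κ (K - q) (K - p) = κ p q) {p q : ℕ} (hp : p ≤ m * K)
    (hq : q ≤ m * K) :
    cycleKernel m l κ (m * K - q) (m * K - p) = cycleKernel m l κ p q := by
  obtain ⟨P, i, hi, rfl⟩ := exists_eq_mul_add hm p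
  obtain ⟨C, j, hj, hC⟩ := exists_add_eq_mul hm q
  have hPK : P ≤ K := le_of_mul_le_mul_left (by omega : m * P ≤ m * K) hm
  have hCK : C ≤ K := Nat.lt_succ_iff.1 <| Nat.lt_of_mul_lt_mul_left (a := m) <| by
    rw [Nat.mul_succ]; omega
  have hrow : m * K - q = m * (K - C) + j := by
    have := Nat.mul_le_mul_left m hCK
    rw [Nat.mul_sub]; omega
  have hcol : m * K - (m * P + i) + i = m * (K - P) := by rw [Nat.mul_sub]; omega
  have hcond : (K - P = K - C + 1 ∧ m ≤ j + i) ↔ (C = P + 1 ∧ m ≤ i + j) := by omega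
  rw [hrow, cycleKernel_apply hj hi hcol, cycleKernel_apply hi hj hC, hκ P hPK C hCK, add_comm j i]
  simp only [add_comm j i] at hcond
  simp only [hcond]
  ring

theorem resKernel_eq_errKernel {κ : ℕ → ℕ → α} {K : ℕ}
    (hlow : ∀ {p q}, p < q → κ p q = 0)
    (hκ : ∀ p ≤ K, ∀ q ≤ K, κ (K - q) (K - p) = κ p q) (μ : α) {p q : ℕ} (hp : p ≤ K)
    (hq : q ≤ K) : resKernel μ κ p q = errKernel μ κ (K - q) (K - p) := by
  rw [resKernel, errKernel, hκ p hp q hq]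
  congr 1
  · congr 1
    exact if_congr (by omega) rfl rfl
  · rcases Nat.eq_zero_or_pos p with rfl | hp0
    · rw [if_pos rfl, Nat.sub_zero, hlow (by omega : K - q < K + 1), zero_mul]
    · rw [if_neg hp0.ne', show K - p + 1 = K - (p - 1) by omega, hκ _ (by omega) q hq, mul_comm]

end Persymmetry

section BlockMatrices

variable {ι R : Type*}

/-- The block matrix with `n` block rows, `n'` block columns, and block `K p q` at `(p, q)`. -/
def blockMatrix (n n' : ℕ) (K : ℕ → ℕ → Matrix ι ι R) : Matrix (Fin n × ι) (Fin n' × ι) R :=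
  Matrix.of fun p q => K p.1 q.1 p.2 q.2

theorem blockMatrix_apply (n n' : ℕ) (K : ℕ → ℕ → Matrix ι ι R) (p : Fin n × ι) (q : Fin n' × ι) :
    blockMatrix n n' K p q = K p.1 q.1 p.2 q.2 := rfl

theorem blockMatrix_congr {n n' : ℕ} {K L : ℕ → ℕ → Matrix ι ι R}
    (h : ∀ p < n, ∀ q < n', K p q = L p q) : blockMatrix n n' K = blockMatrix n n' L := by
  ext p q
  rw [blockMatrix_apply, blockMatrix_apply, h p.1 p.1.isLt q.1 q.1.isLt]

variable [Ring R]

theorem blockMatrix_add (n n' : ℕ) (K L : ℕ → ℕ → Matrix ι ι R) :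
    blockMatrix n n' K + blockMatrix n n' L = blockMatrix n n' fun p q => K p q + L p q := rfl

theorem blockMatrix_sub (n n' : ℕ) (K L : ℕ → ℕ → Matrix ι ι R) :
    blockMatrix n n' K - blockMatrix n n' L = blockMatrix n n' fun p q => K p q - L p q := rfl

theorem blockMatrix_one [DecidableEq ι] (n : ℕ) :
    blockMatrix n n (fun p q => if p = q then (1 : Matrix ι ι R) else 0) = 1 := by
  ext ⟨p, a⟩ ⟨q, b⟩
  by_cases hpq : p = q <;> simp [blockMatrix, Matrix.one_apply, hpq, Fin.val_inj]

variable [Fintype ι]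

theorem blockMatrix_mul_apply {n n' n'' : ℕ} (K L : ℕ → ℕ → Matrix ι ι R) (p : Fin n × ι)
    (q : Fin n'' × ι) :
    (blockMatrix n n' K * blockMatrix n' n'' L) p q =
      ∑ r : Fin n', (K p.1 r * L r q.1) p.2 q.2 := by
  rw [Matrix.mul_apply, Fintype.sum_prod_type]
  rfl

theorem blockMatrix_mul_of_single_row {n n' n'' : ℕ} (K : ℕ → ℕ → Matrix ι ι R) {e : ℕ → ℕ}
    (a : ℕ → Matrix ι ι R) (he : ∀ p < n, e p < n') :
    blockMatrix n n' (fun p r => if r = e p then a p else 0) * blockMatrix n' n'' K =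
      blockMatrix n n'' fun p q => a p * K (e p) q := by
  ext p q
  rw [blockMatrix_mul_apply, Fintype.sum_eq_single ⟨e p.1, he p.1 p.1.isLt⟩]
  · simp [blockMatrix]
  · intro r hr
    have hne : (r : ℕ) ≠ e p.1 := fun h => hr (Fin.ext h)
    simp [hne]

theorem blockMatrix_mul_of_single_col {n n' n'' : ℕ} (K : ℕ → ℕ → Matrix ι ι R) {e : ℕ → ℕ}
    (a : ℕ → Matrix ι ι R) (he : ∀ p < n, ∀ q < n'', n' ≤ e q → K p (e q) = 0) :
    blockMatrix n n' K * blockMatrix n' n'' (fun r q => if r = e q then a q else 0) =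
      blockMatrix n n'' fun p q => K p (e q) * a q := by
  ext p q
  rw [blockMatrix_mul_apply, blockMatrix_apply]
  rcases lt_or_ge (e q.1) n' with hlt | hge
  · rw [Fintype.sum_eq_single ⟨e q.1, hlt⟩]
    · simp
    · intro r hr
      have hne : (r : ℕ) ≠ e q.1 := fun h => hr (Fin.ext h)
      simp [hne]
  · rw [he p.1 p.1.isLt q.1 q.1.isLt hge]
    refine (Finset.sum_eq_zero fun r _ => ?_).trans (by simp)
    have hne : (r : ℕ) ≠ e q.1 := (r.isLt.trans_le hge).ne
    simp [hne]

end BlockMatrices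

section SystemMatrix

variable {Nx : ℕ}

theorem systemMatrix_eq (n : ℕ) (Φ : SpaceOp Nx) :
    systemMatrix n Φ = 1 - blockMatrix n n fun p q => if p = q + 1 then Φ else 0 := by
  rw [← blockMatrix_one, blockMatrix_sub]
  ext ⟨p, a⟩ ⟨q, b⟩
  rw [systemMatrix, blockMatrix_apply, Matrix.of_apply]
  rcases eq_or_ne (p : ℕ) q with hpq | hpq
  · simp [hpq]
  · by_cases hsucc : (p : ℕ) = q + 1 <;> simp [hpq, hsucc]

theorem one_sub_blockMatrix_mul_systemMatrix {n : ℕ} {κ : ℕ → ℕ → SpaceOp Nx} (hκ : UnitLower κ)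
    (Ψ : SpaceOp Nx) :
    1 - blockMatrix n n κ * systemMatrix n Ψ = blockMatrix n n (errKernel Ψ κ) := by
  have hout : ∀ p < n, ∀ q < n, n ≤ q + 1 → κ p (q + 1) = 0 :=
    fun p hp q _ hq => hκ.eq_zero_of_lt (hp.trans_le hq)
  rw [systemMatrix_eq, Matrix.mul_sub, Matrix.mul_one, blockMatrix_mul_of_single_col _ _ hout,
    ← sub_add, ← blockMatrix_one, blockMatrix_sub, blockMatrix_add]
  rfl

theorem one_sub_systemMatrix_mul_blockMatrix {n : ℕ} (Ψ : SpaceOp Nx)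
    (κ : ℕ → ℕ → SpaceOp Nx) :
    1 - systemMatrix n Ψ * blockMatrix n n κ = blockMatrix n n (resKernel Ψ κ) := by
  have hshift : blockMatrix n n (fun p q => if p = q + 1 then Ψ else 0) =
      blockMatrix n n fun p r => if r = p - 1 then (if p = 0 then 0 else Ψ) else 0 := by
    refine blockMatrix_congr fun p _ r _ => ?_
    rcases p with _ | p <;> simp [eq_comm]
  rw [systemMatrix_eq, hshift, Matrix.sub_mul, Matrix.one_mul,
    blockMatrix_mul_of_single_row _ _ (by omega), ← sub_add, ← blockMatrix_one, blockMatrix_sub,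
    blockMatrix_add]
  simp only [ite_mul, zero_mul]
  rfl

theorem invKernel_mul_systemMatrix (n : ℕ) (Φ : SpaceOp Nx) :
    blockMatrix n n (invKernel Φ) * systemMatrix n Φ = 1 := by
  rw [← sub_eq_zero, ← neg_eq_zero, neg_sub,
    one_sub_blockMatrix_mul_systemMatrix (unitLower_invKernel Φ)]
  ext p q
  rw [blockMatrix_apply, errKernel_invKernel, sub_self, mul_zero, Matrix.zero_apply,
    Matrix.zero_apply]

theorem inv_systemMatrix (n : ℕ) (Φ : SpaceOp Nx) :
    (systemMatrix n Φ)⁻¹ = blockMatrix n n (invKernel Φ) :=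
  Matrix.inv_eq_left_inv (invKernel_mul_systemMatrix n Φ)

theorem inv_mul_systemMatrix (n : ℕ) (Φ : SpaceOp Nx) :
    (systemMatrix n Φ)⁻¹ * systemMatrix n Φ = 1 := by
  rw [inv_systemMatrix, invKernel_mul_systemMatrix]

theorem systemMatrix_mul_inv (n : ℕ) (Φ : SpaceOp Nx) :
    systemMatrix n Φ * (systemMatrix n Φ)⁻¹ = 1 :=
  mul_eq_one_comm.1 (inv_mul_systemMatrix n Φ)

end SystemMatrix

theorem schur_complement_inv {n f c R : Type*} [Fintype n] [DecidableEq n] [Fintype f]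
    [DecidableEq f] [Fintype c] [DecidableEq c] [CommRing R] {A B : Matrix n n R}
    {S : Matrix n f R} {J : Matrix c n R} {D : Matrix c c R} (hAB : A * B = 1)
    (hSS : Sᵀ * S = 1) (hJJ : J * Jᵀ = 1) (hSJ : S * Sᵀ + Jᵀ * J = 1) (hD : J * B * Jᵀ * D = 1) :
    S * (Sᵀ * A * S)⁻¹ * Sᵀ = B - B * Jᵀ * D * J * B := by
  have hJS : J * S = 0 := by
    have h : J * (S * Sᵀ + Jᵀ * J) * S = J * S := by rw [hSJ, Matrix.mul_one]
    rw [Matrix.mul_add, Matrix.add_mul, ← Matrix.mul_assoc J Jᵀ, hJJ, Matrix.one_mul,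
      Matrix.mul_assoc, Matrix.mul_assoc S, hSS, Matrix.mul_one] at h
    simpa using h
  have hSJ' : Sᵀ * Jᵀ = 0 := by rw [← Matrix.transpose_mul, hJS, Matrix.transpose_zero]
  have hD' : D * (J * B * Jᵀ) = 1 := mul_eq_one_comm.1 hD
  set G := B - B * Jᵀ * D * J * B with hG
  have hJG : J * G = 0 := by
    rw [hG, Matrix.mul_sub, sub_eq_zero]
    simp only [← Matrix.mul_assoc, hD, Matrix.one_mul]
  have hGJ : G * Jᵀ = 0 := by
    simp only [Matrix.mul_assoc] at hD'
    rw [hG, Matrix.sub_mul, sub_eq_zero]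
    simp only [Matrix.mul_assoc, hD', Matrix.mul_one]
  have hSG : S * Sᵀ * G = G := by
    rw [eq_sub_of_add_eq hSJ, Matrix.sub_mul, Matrix.mul_assoc, hJG, Matrix.mul_zero,
      Matrix.one_mul, sub_zero]
  have hGS : G * (S * Sᵀ) = G := by
    rw [eq_sub_of_add_eq hSJ, Matrix.mul_sub, ← Matrix.mul_assoc, hGJ, Matrix.zero_mul,
      Matrix.mul_one, sub_zero]
  have hAG : A * G = 1 - Jᵀ * D * J * B := by
    rw [hG, Matrix.mul_sub, hAB]
    simp only [← Matrix.mul_assoc, hAB, Matrix.one_mul]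
  have hinv : Sᵀ * A * S * (Sᵀ * G * S) = 1 := by
    calc Sᵀ * A * S * (Sᵀ * G * S) = Sᵀ * (A * (S * Sᵀ * G)) * S := by
          simp only [Matrix.mul_assoc]
      _ = Sᵀ * S - Sᵀ * Jᵀ * (D * J * B * S) := by
          rw [hSG, hAG]
          simp only [Matrix.mul_sub, Matrix.sub_mul, Matrix.mul_one, Matrix.mul_assoc]
      _ = 1 := by rw [hSS, hSJ', Matrix.zero_mul, sub_zero]
  rw [Matrix.inv_eq_right_inv hinv]
  calc S * (Sᵀ * G * S) * Sᵀ = S * Sᵀ * (G * (S * Sᵀ)) := by simp only [Matrix.mul_assoc]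
    _ = G := by rw [hGS, hSG]

/-- A grid with `n'` time points is the coarsening by the factor `m` of a grid with `n` time points;
the last point of the fine grid is a C-point. -/
structure Coarsening (n n' m : ℕ) : Prop where
  factor_pos : 0 < m
  coarse_pos : 0 < n'
  fine_eq : n = m * (n' - 1) + 1

section TransferOperators

variable {Nx n n' m : ℕ}

theorem Coarsening.div_lt (h : Coarsening n n' m) {p : ℕ} (hp : p < n) : p / m < n' := by
  have hle : p / m ≤ n' - 1 := Nat.div_le_of_le_mul (by have := h.fine_eq; omega)
  have := h.coarse_pos
  omega

theorem Coarsening.ceilDiv_lt (h : Coarsening n n' m) {p : ℕ} (hp : p < n) : p ⌈/⌉ m < n' := by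
  have hle : p ⌈/⌉ m ≤ n' - 1 :=
    (ceilDiv_le_iff_le_mul h.factor_pos).2 (by have := h.fine_eq; omega)
  have := h.coarse_pos
  omega

theorem Coarsening.mul_lt (h : Coarsening n n' m) {c : ℕ} (hc : c < n') : m * c < n := by
  have := Nat.mul_le_mul_left m (Nat.le_sub_one_of_lt hc)
  have := h.fine_eq
  omega

theorem injection_eq (Nx n n' m : ℕ) :
    injection Nx n n' m = blockMatrix n' n fun c p => if p = m * c then 1 else 0 := by
  ext c p
  rw [injection, blockMatrix_apply, Matrix.of_apply, mul_comm m]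
  split_ifs <;> rfl

theorem injection_transpose_eq (Nx n n' m : ℕ) :
    (injection Nx n n' m)ᵀ = blockMatrix n n' fun p c => if p = m * c then 1 else 0 := by
  ext p c
  rw [Matrix.transpose_apply, injection_eq, blockMatrix_apply, blockMatrix_apply]
  split_ifs
  · simp only [Matrix.one_apply, eq_comm]
  · rfl

theorem interpolation_eq (hm : 0 < m) (n n' : ℕ) (Φ : SpaceOp Nx) :
    interpolation n n' m Φ = blockMatrix n n' fun p c => if c = p / m then Φ ^ (p % m) else 0 := by
  ext ⟨p, a⟩ ⟨c, b⟩
  have hcond : (c.val * m ≤ p.val ∧ p.val < c.val * m + m) ↔ c.val = p.val / m := by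
    rw [eq_comm, Nat.div_eq_iff hm]
    omega
  rw [interpolation, blockMatrix_apply, Matrix.of_apply]
  simp only [hcond]
  split_ifs with hc
  · rw [hc, ← Nat.mod_eq_sub_div_mul]
  · rfl

theorem restriction_eq (hm : 0 < m) (n n' : ℕ) (Φ : SpaceOp Nx) :
    restriction n n' m Φ =
      blockMatrix n' n fun c p => if c = p ⌈/⌉ m then Φ ^ (m * (p ⌈/⌉ m) - p) else 0 := by
  ext ⟨c, a⟩ ⟨p, b⟩
  obtain ⟨C, j, hj, hp⟩ := exists_add_eq_mul hm p.val
  have hcond : (p.val ≤ c.val * m ∧ c.val * m < p.val + m) ↔ c.val = p.val ⌈/⌉ m := by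
    rw [ceilDiv_of_add_eq_mul hj hp, mul_comm _ m]
    constructor
    · rintro ⟨h₁, h₂⟩
      refine le_antisymm ?_ ?_ <;>
        refine Nat.lt_succ_iff.1 (Nat.lt_of_mul_lt_mul_left (a := m) ?_) <;>
        rw [Nat.mul_succ] <;> omega
    · rintro hc
      rw [hc]
      omega
  rw [restriction, blockMatrix_apply, Matrix.of_apply]
  simp only [hcond]
  split_ifs with hc
  · rw [hc, mul_comm m]
  · rfl

theorem injection_mul_blockMatrix (h : Coarsening n n' m) (k : ℕ) (K : ℕ → ℕ → SpaceOp Nx) :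
    injection Nx n n' m * blockMatrix n k K = blockMatrix n' k fun c q => K (m * c) q := by
  rw [injection_eq, blockMatrix_mul_of_single_row K (fun _ => 1) fun c hc => h.mul_lt hc]
  simp only [one_mul]

theorem blockMatrix_mul_injection_transpose (h : Coarsening n n' m) (k : ℕ)
    (K : ℕ → ℕ → SpaceOp Nx) :
    blockMatrix k n K * (injection Nx n n' m)ᵀ = blockMatrix k n' fun p c => K p (m * c) := by
  rw [injection_transpose_eq, blockMatrix_mul_of_single_col K (fun _ => 1)
    fun _ _ c hc hge => absurd (h.mul_lt hc) hge.not_gt]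
  simp only [mul_one]

theorem interpolation_mul_blockMatrix (h : Coarsening n n' m) (Φ : SpaceOp Nx) (k : ℕ)
    (K : ℕ → ℕ → SpaceOp Nx) :
    interpolation n n' m Φ * blockMatrix n' k K =
      blockMatrix n k fun p q => Φ ^ (p % m) * K (p / m) q := by
  rw [interpolation_eq h.factor_pos, blockMatrix_mul_of_single_row K _ fun p hp => h.div_lt hp]

theorem blockMatrix_mul_restriction (h : Coarsening n n' m) (Φ : SpaceOp Nx) (k : ℕ)
    (K : ℕ → ℕ → SpaceOp Nx) :
    blockMatrix k n' K * restriction n n' m Φ =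
      blockMatrix k n fun p q => K p (q ⌈/⌉ m) * Φ ^ (m * (q ⌈/⌉ m) - q) := by
  rw [restriction_eq h.factor_pos, blockMatrix_mul_of_single_col K _
    fun _ _ q hq hge => absurd (h.ceilDiv_lt hq) hge.not_gt]

theorem injection_mul_transpose (h : Coarsening n n' m) :
    injection Nx n n' m * (injection Nx n n' m)ᵀ = 1 := by
  rw [injection_transpose_eq, injection_mul_blockMatrix h, ← blockMatrix_one]
  refine blockMatrix_congr fun c _ d _ => ?_
  simp only [Nat.mul_right_inj h.factor_pos.ne']

theorem fEmbedding_transpose_mul_self (Nx n m : ℕ) :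
    (fEmbedding Nx n m)ᵀ * fEmbedding Nx n m = 1 := by
  ext ⟨p, a⟩ ⟨q, b⟩
  rw [Matrix.mul_apply, Fintype.sum_eq_single (p.1, a)]
  · simp [fEmbedding, Matrix.one_apply, Subtype.ext_iff, ite_and]
  · rintro ⟨r, d⟩ hne
    have hzero : fEmbedding Nx n m (r, d) (p, a) = 0 := by
      simp only [fEmbedding, Matrix.of_apply, Matrix.one_apply]
      grind
    rw [Matrix.transpose_apply, hzero, zero_mul]

theorem injection_transpose_mul_self (h : Coarsening n n' m) :
    (injection Nx n n' m)ᵀ * injection Nx n n' m =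
      blockMatrix n n fun p q => if p = q ∧ m ∣ p then 1 else 0 := by
  have hrow : (injection Nx n n' m)ᵀ =
      blockMatrix n n' fun p c => if c = p / m then (if m ∣ p then 1 else 0) else 0 := by
    rw [injection_transpose_eq]
    refine blockMatrix_congr fun p _ c _ => ?_
    rw [← ite_and]
    refine if_congr ⟨?_, ?_⟩ rfl rfl
    · rintro rfl
      exact ⟨(Nat.mul_div_cancel_left c h.factor_pos).symm, dvd_mul_right m c⟩
    · rintro ⟨rfl, hp⟩
      exact (Nat.mul_div_cancel' hp).symm
  rw [hrow, injection_eq, blockMatrix_mul_of_single_row _ _ fun p hp => h.div_lt hp]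
  refine blockMatrix_congr fun p _ q _ => ?_
  by_cases hp : m ∣ p
  · simp [hp, Nat.mul_div_cancel' hp, eq_comm]
  · simp [hp]

theorem fEmbedding_mul_transpose (Nx n m : ℕ) :
    fEmbedding Nx n m * (fEmbedding Nx n m)ᵀ =
      blockMatrix n n fun p q => if p = q ∧ ¬ m ∣ p then 1 else 0 := by
  ext ⟨p, a⟩ ⟨q, b⟩
  have hzero {r : FPoint n m} (hr : p ≠ r.val) (d : Fin Nx) :
      fEmbedding Nx n m (p, a) (r, d) = 0 := if_neg hr
  rw [Matrix.mul_apply, blockMatrix_apply, Fintype.sum_prod_type]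
  by_cases hp : m ∣ p.val
  · have hne (r : FPoint n m) : p ≠ r.val := fun hpr => r.2 (hpr ▸ hp)
    simp [hzero (hne _), hp]
  · rw [Fintype.sum_eq_single ⟨p, hp⟩ fun r hr =>
      Finset.sum_eq_zero fun d _ => by rw [hzero fun hpr => hr (Subtype.ext hpr.symm), zero_mul]]
    rcases eq_or_ne p q with rfl | hpq
    · simp [fEmbedding, Matrix.one_apply, hp]
    · simp [fEmbedding, hpq, Ne.symm hpq, Fin.val_inj]

theorem fEmbedding_mul_transpose_add (h : Coarsening n n' m) :
    fEmbedding Nx n m * (fEmbedding Nx n m)ᵀ + (injection Nx n n' m)ᵀ * injection Nx n n' m =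
      1 := by
  rw [injection_transpose_mul_self h, fEmbedding_mul_transpose, blockMatrix_add, ← blockMatrix_one]
  refine blockMatrix_congr fun p _ q _ => ?_
  by_cases hp : m ∣ p <;> simp [hp]

theorem injection_mul_inv_mul_transpose (h : Coarsening n n' m) (Φ : SpaceOp Nx) :
    injection Nx n n' m * (systemMatrix n Φ)⁻¹ * (injection Nx n n' m)ᵀ =
      (systemMatrix n' (Φ ^ m))⁻¹ := by
  rw [inv_systemMatrix, inv_systemMatrix, injection_mul_blockMatrix h,
    blockMatrix_mul_injection_transpose h]
  refine blockMatrix_congr fun c _ d _ => ?_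
  rw [← cycleKernel_invKernel h.factor_pos, ← add_zero (m * c), cycleKernel_mul_right h.factor_pos]
  simp

theorem inv_mul_injection_transpose (h : Coarsening n n' m) (Φ : SpaceOp Nx) :
    (systemMatrix n Φ)⁻¹ * (injection Nx n n' m)ᵀ =
      interpolation n n' m Φ * (systemMatrix n' (Φ ^ m))⁻¹ := by
  rw [inv_systemMatrix, inv_systemMatrix, interpolation_mul_blockMatrix h,
    blockMatrix_mul_injection_transpose h]
  refine blockMatrix_congr fun p _ c _ => ?_
  obtain ⟨P, i, hi, rfl⟩ := exists_eq_mul_add h.factor_pos p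
  rw [← cycleKernel_invKernel h.factor_pos, cycleKernel_mul_right hi, mul_add_div_of_lt hi,
    mul_add_mod_of_lt hi]

theorem injection_mul_inv (h : Coarsening n n' m) (Φ : SpaceOp Nx) :
    injection Nx n n' m * (systemMatrix n Φ)⁻¹ =
      (systemMatrix n' (Φ ^ m))⁻¹ * restriction n n' m Φ := by
  rw [inv_systemMatrix, inv_systemMatrix, blockMatrix_mul_restriction h,
    injection_mul_blockMatrix h]
  refine blockMatrix_congr fun c _ q _ => ?_
  obtain ⟨C, j, hj, hq⟩ := exists_add_eq_mul h.factor_pos q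
  rw [← cycleKernel_invKernel h.factor_pos, ← add_zero (m * c),
    cycleKernel_apply h.factor_pos hj hq, if_neg (by omega), ceilDiv_of_add_eq_mul hj hq, ← hq,
    Nat.add_sub_cancel_left]
  simp

theorem systemMatrix_mul_interpolation (h : Coarsening n n' m) (Φ : SpaceOp Nx) :
    systemMatrix n Φ * interpolation n n' m Φ =
      (injection Nx n n' m)ᵀ * systemMatrix n' (Φ ^ m) := by
  rw [← Matrix.mul_one (interpolation n n' m Φ), ← inv_mul_systemMatrix n' (Φ ^ m),
    ← Matrix.mul_assoc (interpolation n n' m Φ), ← inv_mul_injection_transpose h,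
    ← Matrix.mul_assoc, ← Matrix.mul_assoc, systemMatrix_mul_inv, Matrix.one_mul]

theorem injection_mul_interpolation (h : Coarsening n n' m) (Φ : SpaceOp Nx) :
    injection Nx n n' m * interpolation n n' m Φ = 1 := by
  rw [← Matrix.mul_one (interpolation n n' m Φ), ← inv_mul_systemMatrix n' (Φ ^ m),
    ← Matrix.mul_assoc (interpolation n n' m Φ), ← inv_mul_injection_transpose h,
    ← Matrix.mul_assoc, ← Matrix.mul_assoc, injection_mul_inv_mul_transpose h]

theorem restriction_mul_injection_transpose (h : Coarsening n n' m) (Φ : SpaceOp Nx) :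
    restriction n n' m Φ * (injection Nx n n' m)ᵀ = 1 := by
  rw [← Matrix.one_mul (restriction n n' m Φ), ← systemMatrix_mul_inv n' (Φ ^ m),
    Matrix.mul_assoc (systemMatrix n' _), ← injection_mul_inv h, Matrix.mul_assoc,
    injection_mul_inv_mul_transpose h]

theorem fSolve_eq (h : Coarsening n n' m) (Φ : SpaceOp Nx) :
    fSolve n m Φ = (systemMatrix n Φ)⁻¹ -
      interpolation n n' m Φ * (systemMatrix n' (Φ ^ m))⁻¹ * restriction n n' m Φ := by
  have hD : injection Nx n n' m * (systemMatrix n Φ)⁻¹ * (injection Nx n n' m)ᵀ *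
      systemMatrix n' (Φ ^ m) = 1 := by
    rw [injection_mul_inv_mul_transpose h, inv_mul_systemMatrix]
  rw [fSolve, schur_complement_inv (systemMatrix_mul_inv n Φ)
    (fEmbedding_transpose_mul_self Nx n m) (injection_mul_transpose h)
    (fEmbedding_mul_transpose_add h) hD, inv_mul_injection_transpose h,
    Matrix.mul_assoc (interpolation n n' m Φ), inv_mul_systemMatrix, Matrix.mul_one,
    Matrix.mul_assoc, injection_mul_inv h, Matrix.mul_assoc]

theorem systemMatrix_mul_fSolve (h : Coarsening n n' m) (Φ : SpaceOp Nx) :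
    systemMatrix n Φ * fSolve n m Φ = 1 - (injection Nx n n' m)ᵀ * restriction n n' m Φ := by
  rw [fSolve_eq h, Matrix.mul_sub, systemMatrix_mul_inv, ← Matrix.mul_assoc, ← Matrix.mul_assoc,
    systemMatrix_mul_interpolation h, Matrix.mul_assoc _ _ (systemMatrix n' _)⁻¹,
    systemMatrix_mul_inv, Matrix.mul_one]

theorem fSolve_add_interpolation_mul_restriction (h : Coarsening n n' m) (Φ : SpaceOp Nx)
    (κ : ℕ → ℕ → SpaceOp Nx) :
    fSolve n m Φ + interpolation n n' m Φ * blockMatrix n' n' κ * restriction n n' m Φ =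
      blockMatrix n n (cycleKernel m Φ κ) := by
  rw [fSolve_eq h, inv_systemMatrix, inv_systemMatrix, ← cycleKernel_invKernel h.factor_pos,
    interpolation_mul_blockMatrix h, interpolation_mul_blockMatrix h,
    blockMatrix_mul_restriction h, blockMatrix_mul_restriction h, blockMatrix_sub, blockMatrix_add]
  refine blockMatrix_congr fun p _ q _ => ?_
  simp only [cycleKernel, add_sub_cancel_right]

end TransferOperators

section LevelOne

variable {α β : Type*} [Ring α] [Ring β]

/-- The kernel of the error propagator on level `1`; its argument `l` lists the time-stepping
operators (or their eigenvalues for one mode) on the four levels. -/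
def levelOneErrorKernel (m : ℕ → ℕ) (l : ℕ → α) : ℕ → ℕ → α :=
  errKernel (l 0 ^ m 0) (vCycleKernel m l 2 1)

/-- The kernel of the residual propagator on level `1`. -/
def levelOneResidualKernel (m : ℕ → ℕ) (l : ℕ → α) : ℕ → ℕ → α :=
  resKernel (l 0 ^ m 0) (vCycleKernel m l 2 1)

theorem levelOneErrorKernel_map (f : α →+* β) (m : ℕ → ℕ) {l : ℕ → α} {l' : ℕ → β}
    (h : ∀ ℓ < 4, l' ℓ = f (l ℓ)) (p q : ℕ) :
    levelOneErrorKernel m l' p q = f (levelOneErrorKernel m l p q) := by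
  rw [levelOneErrorKernel, levelOneErrorKernel, map_errKernel, map_pow, h 0 (by omega),
    map_vCycleKernel f m 2 fun i _ hi => h i (by omega)]

theorem levelOneResidualKernel_map (f : α →+* β) (m : ℕ → ℕ) {l : ℕ → α} {l' : ℕ → β}
    (h : ∀ ℓ < 4, l' ℓ = f (l ℓ)) (p q : ℕ) :
    levelOneResidualKernel m l' p q = f (levelOneResidualKernel m l p q) := by
  rw [levelOneResidualKernel, levelOneResidualKernel, map_resKernel, map_pow, h 0 (by omega),
    map_vCycleKernel f m 2 fun i _ hi => h i (by omega)]

end LevelOne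

section Multigrid

variable {Nx : ℕ} {m N : ℕ → ℕ}

/-- The matrix of the linear map taking a right-hand side on level `ℓ` to the result of a V-cycle
with zero initial guess and `c` coarser levels. -/
def vCycleMatrix (m N : ℕ → ℕ) (Φ : ℕ → SpaceOp Nx) :
    ℕ → (ℓ : ℕ) → STMat (N ℓ) (N ℓ) Nx
  | 0, ℓ => (Amat N Φ ℓ)⁻¹
  | c + 1, ℓ =>
    Fmat m N Φ ℓ + Pmat m N Φ ℓ * vCycleMatrix m N Φ c (ℓ + 1) * Rmat m N Φ ℓ

theorem vCycleMatrix_eq_blockMatrix (Φ : ℕ → SpaceOp Nx) (c : ℕ) {ℓ : ℕ}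
    (h : ∀ i, ℓ ≤ i → i < ℓ + c → Coarsening (N i) (N (i + 1)) (m i)) :
    vCycleMatrix m N Φ c ℓ = blockMatrix (N ℓ) (N ℓ) (vCycleKernel m Φ c ℓ) := by
  induction c generalizing ℓ with
  | zero => exact inv_systemMatrix (N ℓ) (Φ ℓ)
  | succ c ih =>
    rw [vCycleMatrix, ih fun i h₁ h₂ => h i (by omega) (by omega)]
    exact fSolve_add_interpolation_mul_restriction (h ℓ le_rfl (by omega)) (Φ ℓ) _

theorem sub_mulVec_fRelax (Φ : ℕ → SpaceOp Nx) {ℓ : ℕ}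
    (h : Coarsening (N ℓ) (N (ℓ + 1)) (m ℓ)) (b x : STVec (N ℓ) Nx) :
    b - Amat N Φ ℓ *ᵥ fRelax m N Φ ℓ b x =
      (RImat Nx m N ℓ)ᵀ *ᵥ (Rmat m N Φ ℓ *ᵥ (b - Amat N Φ ℓ *ᵥ x)) := by
  rw [fRelax, Matrix.mulVec_add, Matrix.mulVec_mulVec, Amat, Fmat, systemMatrix_mul_fSolve h,
    Matrix.sub_mulVec, Matrix.one_mulVec, Matrix.mulVec_mulVec, RImat, Rmat]
  abel

theorem restriction_mulVec_sub_mulVec_fRelax (Φ : ℕ → SpaceOp Nx) {ℓ : ℕ}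
    (h : Coarsening (N ℓ) (N (ℓ + 1)) (m ℓ)) (b x : STVec (N ℓ) Nx) :
    Rmat m N Φ ℓ *ᵥ (b - Amat N Φ ℓ *ᵥ fRelax m N Φ ℓ b x) =
      Rmat m N Φ ℓ *ᵥ (b - Amat N Φ ℓ *ᵥ x) := by
  rw [sub_mulVec_fRelax Φ h, Matrix.mulVec_mulVec, Rmat, RImat,
    restriction_mul_injection_transpose h, Matrix.one_mulVec]

theorem vCycle_zero_guess (Φ : ℕ → SpaceOp Nx) (c : ℕ) {ℓ : ℕ}
    (h : ∀ i, ℓ ≤ i → i < ℓ + c → Coarsening (N i) (N (i + 1)) (m i)) (b : STVec (N ℓ) Nx) :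
    vCycle m N Φ c ℓ b 0 = vCycleMatrix m N Φ c ℓ *ᵥ b := by
  induction c generalizing ℓ with
  | zero => rfl
  | succ c ih =>
    rw [vCycle, restriction_mulVec_sub_mulVec_fRelax Φ (h ℓ le_rfl (by omega)),
      ih fun i h₁ h₂ => h i (by omega) (by omega), fRelax, Matrix.mulVec_zero, sub_zero, zero_add,
      vCycleMatrix, Matrix.add_mulVec, Matrix.mulVec_mulVec, Matrix.mulVec_mulVec]

theorem sub_mulVec_vCycle (Φ : ℕ → SpaceOp Nx) (c : ℕ) {ℓ : ℕ}
    (h : ∀ i, ℓ ≤ i → i ≤ ℓ + c → Coarsening (N i) (N (i + 1)) (m i)) (b x : STVec (N ℓ) Nx) :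
    b - Amat N Φ ℓ *ᵥ vCycle m N Φ (c + 1) ℓ b x =
      (RImat Nx m N ℓ)ᵀ *ᵥ
        ((1 - systemMatrix (N (ℓ + 1)) (Φ ℓ ^ m ℓ) * vCycleMatrix m N Φ c (ℓ + 1)) *ᵥ
          (Rmat m N Φ ℓ *ᵥ (b - Amat N Φ ℓ *ᵥ x))) := by
  have hℓ := h ℓ le_rfl (by omega)
  have hAP : Amat N Φ ℓ * Pmat m N Φ ℓ =
      (RImat Nx m N ℓ)ᵀ * systemMatrix (N (ℓ + 1)) (Φ ℓ ^ m ℓ) :=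
    systemMatrix_mul_interpolation hℓ (Φ ℓ)
  rw [vCycle, restriction_mulVec_sub_mulVec_fRelax Φ hℓ,
    vCycle_zero_guess Φ c fun i h₁ h₂ => h i (by omega) (by omega), Matrix.mulVec_add, ← sub_sub,
    sub_mulVec_fRelax Φ hℓ, Matrix.mulVec_mulVec _ (Amat N Φ ℓ), hAP, Matrix.sub_mulVec,
    Matrix.one_mulVec]
  simp only [Matrix.mulVec_sub, Matrix.mulVec_mulVec, Matrix.mul_assoc]

theorem coarseErrorPropagator_eq (Φ : ℕ → SpaceOp Nx) (h : Coarsening (N 0) (N 1) (m 0)) :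
    coarseErrorPropagator m N Φ =
      1 - vCycleMatrix m N Φ 2 1 * systemMatrix (N 1) (Φ 0 ^ m 0) := by
  have hIP : RImat Nx m N 0 * Pmat m N Φ 0 = 1 := injection_mul_interpolation h (Φ 0)
  have hRAP : Rmat m N Φ 0 * (Amat N Φ 0 * Pmat m N Φ 0) = systemMatrix (N 1) (Φ 0 ^ m 0) := by
    rw [Amat, Pmat, Rmat, systemMatrix_mul_interpolation h, ← Matrix.mul_assoc,
      restriction_mul_injection_transpose h, Matrix.one_mul]
  have hIP' (M : STMat (N 1) (N 1) Nx) : RImat Nx m N 0 * (Pmat m N Φ 0 * M) = M := by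
    rw [← Matrix.mul_assoc, hIP, Matrix.one_mul]
  simp only [coarseErrorPropagator, errorPropagator, vCycleMatrix, Matrix.sub_mul, Matrix.add_mul,
    Matrix.mul_sub, Matrix.mul_add, Matrix.mul_assoc, hIP, hIP', Matrix.mul_one, hRAP]
  abel

theorem coarseErrorPropagator_eq_blockMatrix (Φ : ℕ → SpaceOp Nx)
    (h : ∀ ℓ < 3, Coarsening (N ℓ) (N (ℓ + 1)) (m ℓ)) :
    coarseErrorPropagator m N Φ =
      blockMatrix (N 1) (N 1) (levelOneErrorKernel m Φ) := by
  rw [coarseErrorPropagator_eq Φ (h 0 (by omega)),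
    vCycleMatrix_eq_blockMatrix Φ 2 fun i _ hi => h i hi,
    one_sub_blockMatrix_mul_systemMatrix, levelOneErrorKernel]
  exact unitLower_vCycleKernel Φ 2 fun i _ hi => (h i hi).factor_pos

theorem residual_succ (Φ : ℕ → SpaceOp Nx) (h : ∀ ℓ < 3, Coarsening (N ℓ) (N (ℓ + 1)) (m ℓ))
    (g u₀ : STVec (N 0) Nx) (i : ℕ) :
    residual m N Φ g u₀ (i + 1) =
      (RImat Nx m N 0)ᵀ *ᵥ
        (blockMatrix (N 1) (N 1) (levelOneResidualKernel m Φ) *ᵥ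
          (Rmat m N Φ 0 *ᵥ residual m N Φ g u₀ i)) := by
  rw [residual, iterate, Function.iterate_succ_apply',
    sub_mulVec_vCycle Φ 2 fun i _ hi => h i (by omega),
    vCycleMatrix_eq_blockMatrix Φ 2 fun i _ hi => h i (by omega),
    one_sub_systemMatrix_mul_blockMatrix]
  rfl

theorem FRelaxedStart.transpose_mulVec {Φ : ℕ → SpaceOp Nx} {g u₀ : STVec (N 0) Nx}
    (h : FRelaxedStart m N Φ g u₀) :
    (fEmbedding Nx (N 0) (m 0))ᵀ *ᵥ residual m N Φ g u₀ 0 = 0 := by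
  ext ⟨p, a⟩
  change ∑ q, fEmbedding Nx (N 0) (m 0) q (p, a) * residual m N Φ g u₀ 0 q = 0
  refine Finset.sum_eq_zero fun q _ => ?_
  by_cases hq : q.1 = p.val
  · rw [← Prod.mk.eta (p := q), hq, h p q.2, mul_zero]
  · rw [fEmbedding, Matrix.of_apply, if_neg hq, zero_mul]

theorem exists_residual_eq_transpose_mulVec {Φ : ℕ → SpaceOp Nx}
    (h : ∀ ℓ < 3, Coarsening (N ℓ) (N (ℓ + 1)) (m ℓ)) {g u₀ : STVec (N 0) Nx} {i : ℕ}
    (hi : 1 ≤ i ∨ FRelaxedStart m N Φ g u₀) :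
    ∃ w : STVec (N 1) Nx, residual m N Φ g u₀ i = (RImat Nx m N 0)ᵀ *ᵥ w := by
  rcases i with _ | i
  · have hF := FRelaxedStart.transpose_mulVec (hi.resolve_left (by omega))
    refine ⟨RImat Nx m N 0 *ᵥ residual m N Φ g u₀ 0, ?_⟩
    calc residual m N Φ g u₀ 0
        = (fEmbedding Nx (N 0) (m 0) * (fEmbedding Nx (N 0) (m 0))ᵀ +
            (RImat Nx m N 0)ᵀ * RImat Nx m N 0) *ᵥ residual m N Φ g u₀ 0 := by
          rw [RImat, fEmbedding_mul_transpose_add (h 0 (by omega)), Matrix.one_mulVec]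
      _ = (RImat Nx m N 0)ᵀ *ᵥ (RImat Nx m N 0 *ᵥ residual m N Φ g u₀ 0) := by
          rw [Matrix.add_mulVec, ← Matrix.mulVec_mulVec, ← Matrix.mulVec_mulVec, hF,
            Matrix.mulVec_zero, zero_add]
  · exact ⟨_, residual_succ Φ h g u₀ i⟩

end Multigrid

section MatrixNorms

variable {ι κ ι' κ' : Type*}

theorem absColSum_le_matNorm1 [Fintype ι] [Finite κ] (M : Matrix ι κ ℂ) (q : κ) :
    absColSum M q ≤ matNorm1 M :=
  le_ciSup (Set.finite_range (absColSum M)).bddAbove q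

theorem absRowSum_le_matNormInf [Finite ι] [Fintype κ] (M : Matrix ι κ ℂ) (p : ι) :
    absRowSum M p ≤ matNormInf M :=
  le_ciSup (Set.finite_range (absRowSum M)).bddAbove p

theorem matNormInf_nonneg [Fintype κ] (M : Matrix ι κ ℂ) : 0 ≤ matNormInf M :=
  Real.iSup_nonneg fun _ => Finset.sum_nonneg fun _ _ => norm_nonneg _

theorem matNorm1_submatrix [Fintype ι] [Fintype ι'] (M : Matrix ι κ ℂ) (e : ι' ≃ ι)
    (f : κ' ≃ κ) :
    matNorm1 (M.submatrix e f) = matNorm1 M :=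
  f.iSup_congr fun q => (e.sum_comp fun p => ‖M p (f q)‖).symm

theorem matNormInf_submatrix [Fintype κ] [Fintype κ'] (M : Matrix ι κ ℂ) (e : ι' ≃ ι)
    (f : κ' ≃ κ) :
    matNormInf (M.submatrix e f) = matNormInf M :=
  matNorm1_submatrix Mᵀ f e

theorem sq_norm_mulVec_apply_le [Fintype κ] (M : Matrix ι κ ℂ) (v : κ → ℂ) (p : ι) :
    ‖(M *ᵥ v) p‖ ^ 2 ≤ absRowSum M p * ∑ q, ‖M p q‖ * ‖v q‖ ^ 2 := by
  have htriangle : ‖(M *ᵥ v) p‖ ≤ ∑ q, ‖M p q‖ * ‖v q‖ :=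
    (norm_sum_le _ _).trans_eq (by simp only [norm_mul])
  calc ‖(M *ᵥ v) p‖ ^ 2 ≤ (∑ q, ‖M p q‖ * ‖v q‖) ^ 2 := by gcongr
    _ ≤ absRowSum M p * ∑ q, ‖M p q‖ * ‖v q‖ ^ 2 :=
      Finset.sum_sq_le_sum_mul_sum_of_sq_le_mul _ (fun _ _ => norm_nonneg _)
        (fun _ _ => by positivity) fun _ _ => le_of_eq (by ring)

theorem sum_sq_norm_mulVec_le [Fintype ι] [Fintype κ] (M : Matrix ι κ ℂ) (v : κ → ℂ) :
    ∑ p, ‖(M *ᵥ v) p‖ ^ 2 ≤ matNorm1 M * matNormInf M * ∑ q, ‖v q‖ ^ 2 :=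
  calc ∑ p, ‖(M *ᵥ v) p‖ ^ 2 ≤ ∑ p, matNormInf M * ∑ q, ‖M p q‖ * ‖v q‖ ^ 2 := by
        refine Finset.sum_le_sum fun p _ => (sq_norm_mulVec_apply_le M v p).trans ?_
        gcongr
        exact absRowSum_le_matNormInf M p
    _ = matNormInf M * ∑ q, absColSum M q * ‖v q‖ ^ 2 := by
        rw [← Finset.mul_sum, Finset.sum_comm]
        simp only [absColSum, Finset.sum_mul]
    _ ≤ matNormInf M * ∑ q, matNorm1 M * ‖v q‖ ^ 2 := by
        have := matNormInf_nonneg M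
        gcongr with q _
        exact absColSum_le_matNorm1 M q
    _ = matNorm1 M * matNormInf M * ∑ q, ‖v q‖ ^ 2 := by
        rw [← Finset.mul_sum, ← mul_assoc, mul_comm (matNorm1 M)]

theorem sum_sq_norm_eq_star_dotProduct [Fintype ι] (v : ι → ℂ) :
    ((∑ p, ‖v p‖ ^ 2 : ℝ) : ℂ) = star v ⬝ᵥ v := by
  push_cast
  exact Finset.sum_congr rfl fun p _ => (Complex.conj_mul' (v p)).symm

end MatrixNorms

section EuclideanNorm

variable {Nx n n' : ℕ}

theorem norm2_mulVec_le (M : STMat n n' Nx) (v : STVec n' Nx) :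
    norm2 (M *ᵥ v) ≤ √(matNorm1 M * matNormInf M) * norm2 v := by
  rw [norm2, norm2, ← Real.sqrt_mul' _ (by positivity)]
  exact Real.sqrt_le_sqrt (sum_sq_norm_mulVec_le M v)

theorem norm2_mulVec_of_isometry {M : STMat n n' Nx} (hM : Mᴴ * M = 1) (v : STVec n' Nx) :
    norm2 (M *ᵥ v) = norm2 v := by
  refine congrArg Real.sqrt (Complex.ofReal_injective ?_)
  rw [sum_sq_norm_eq_star_dotProduct, sum_sq_norm_eq_star_dotProduct, Matrix.star_mulVec,
    ← Matrix.dotProduct_mulVec, Matrix.mulVec_mulVec, hM, Matrix.one_mulVec]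

theorem norm2_injection_transpose_mulVec {m : ℕ} (h : Coarsening n n' m) (v : STVec n' Nx) :
    norm2 ((injection Nx n n' m)ᵀ *ᵥ v) = norm2 v := by
  have hreal : (injection Nx n n' m)ᵀᴴ = injection Nx n n' m := by
    ext c p
    simp only [Matrix.conjTranspose_apply, Matrix.transpose_apply, injection, Matrix.of_apply,
      Matrix.one_apply]
    split_ifs <;> simp
  refine norm2_mulVec_of_isometry ?_ v
  rw [hreal, injection_mul_transpose h]

theorem one_kronecker_eq_blockMatrix (n : ℕ) (X : SpaceOp Nx) :
    (1 : Matrix (Fin n) (Fin n) ℂ) ⊗ₖ X = blockMatrix n n fun p q => if q = p then X else 0 := by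
  ext ⟨p, a⟩ ⟨q, b⟩
  rcases eq_or_ne p q with rfl | hpq
  · simp [blockMatrix]
  · have hval : (q : ℕ) ≠ p := fun h => hpq (Fin.ext h.symm)
    simp [blockMatrix, Matrix.one_apply_ne hpq, hval]

theorem blockMatrix_mul_mul (X Y : SpaceOp Nx) (K : ℕ → ℕ → SpaceOp Nx) :
    blockMatrix n n' (fun p q => X * K p q * Y) =
      (1 : Matrix (Fin n) (Fin n) ℂ) ⊗ₖ X * blockMatrix n n' K *
        (1 : Matrix (Fin n') (Fin n') ℂ) ⊗ₖ Y := by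
  have hX := blockMatrix_mul_of_single_row (n'' := n') K (e := id) (fun _ => X)
    (fun p (hp : p < n) => hp)
  have hY := blockMatrix_mul_of_single_col (n := n) (n' := n') (fun p q => X * K p q) (e := id)
    (fun _ => Y) (fun _ _ q hq hle => absurd hq (not_lt.2 hle))
  simp only [id] at hX hY
  rw [← hY, ← hX, one_kronecker_eq_blockMatrix, one_kronecker_eq_blockMatrix]
  simp only [eq_comm]

theorem norm2_one_kronecker_mulVec {X : SpaceOp Nx} (hX : Xᴴ * X = 1) (v : STVec n Nx) :
    norm2 (((1 : Matrix (Fin n) (Fin n) ℂ) ⊗ₖ X) *ᵥ v) = norm2 v := by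
  refine norm2_mulVec_of_isometry ?_ v
  rw [Matrix.conjTranspose_kronecker, ← Matrix.mul_kronecker_mul, hX, Matrix.conjTranspose_one,
    Matrix.one_mul, Matrix.one_kronecker_one]

theorem norm2_blockMatrix_conj_mulVec_le {X : SpaceOp Nx} (hX : X ∈ Matrix.unitaryGroup (Fin Nx) ℂ)
    (K : ℕ → ℕ → SpaceOp Nx) (v : STVec n' Nx) :
    norm2 (blockMatrix n n' (fun p q => X * K p q * Xᴴ) *ᵥ v) ≤
      √(matNorm1 (blockMatrix n n' K) * matNormInf (blockMatrix n n' K)) * norm2 v := by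
  have hX' : Xᴴᴴ * Xᴴ = 1 := by
    rw [Matrix.conjTranspose_conjTranspose]
    exact Matrix.mem_unitaryGroup_iff.1 hX
  rw [blockMatrix_mul_mul, ← Matrix.mulVec_mulVec, ← Matrix.mulVec_mulVec,
    norm2_one_kronecker_mulVec (Matrix.mem_unitaryGroup_iff'.1 hX)]
  exact (norm2_mulVec_le _ _).trans_eq (by rw [norm2_one_kronecker_mulVec hX'])

end EuclideanNorm

section Diagonalization

variable {Nx : ℕ} {m N : ℕ → ℕ} {lam : ℕ → Fin Nx → ℂ}

/-- The ring homomorphism taking the tuple of eigenvalues to the operator with these eigenvalues and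
eigenvector matrix `X`. -/
def spectralHom (X : Matrix.unitaryGroup (Fin Nx) ℂ) : (Fin Nx → ℂ) →+* SpaceOp Nx :=
  (Unitary.conjStarAlgAut ℂ (SpaceOp Nx) X : SpaceOp Nx →+* SpaceOp Nx).comp
    (Matrix.diagonalRingHom (Fin Nx) ℂ)

theorem levelOneErrorKernel_apply (m : ℕ → ℕ) (lam : ℕ → Fin Nx → ℂ) (p q : ℕ) (k : Fin Nx) :
    levelOneErrorKernel m lam p q k = levelOneErrorKernel m (fun ℓ => lam ℓ k) p q :=
  (levelOneErrorKernel_map (Pi.evalRingHom (fun _ => ℂ) k) m (fun _ _ => rfl) p q).symm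

theorem coarsening_card (h : ∀ ℓ < 3, Coarsening (N ℓ) (N (ℓ + 1)) (m ℓ)) :
    N 1 = m 1 * (m 2 * (N 3 - 1)) + 1 := by
  rw [(h 1 (by omega)).fine_eq, (h 2 (by omega)).fine_eq, Nat.add_sub_cancel]

theorem levelOneResidualKernel_eq_sub_sub {α : Type*} [CommRing α] (l : ℕ → α)
    (hm₁ : 0 < m 1) (hm₂ : 0 < m 2) {K p q : ℕ} (hp : p ≤ m 1 * (m 2 * K))
    (hq : q ≤ m 1 * (m 2 * K)) :
    levelOneResidualKernel m l p q =
      levelOneErrorKernel m l (m 1 * (m 2 * K) - q) (m 1 * (m 2 * K) - p) := by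
  have hlow : UnitLower (vCycleKernel m l 2 1) :=
    ((unitLower_invKernel (l 3)).cycleKernel hm₂ (l 2)).cycleKernel hm₁ (l 1)
  refine resKernel_eq_errKernel hlow.eq_zero_of_lt ?_ _ hp hq
  exact fun p hp q hq => cycleKernel_sub_sub hm₁ (l 1)
    (fun p hp q hq => cycleKernel_sub_sub hm₂ (l 2)
      (fun p hp q hq => invKernel_sub_sub (l 3) hp hq) hp hq) hp hq

theorem diagonalizedPropagator_eq (h : ∀ ℓ < 3, Coarsening (N ℓ) (N (ℓ + 1)) (m ℓ)) :
    diagonalizedPropagator m N lam =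
      blockMatrix (N 1) (N 1) fun p q => Matrix.diagonal (levelOneErrorKernel m lam p q) := by
  rw [diagonalizedPropagator, coarseErrorPropagator_eq_blockMatrix _ h]
  exact blockMatrix_congr fun p _ q _ =>
    levelOneErrorKernel_map (Matrix.diagonalRingHom (Fin Nx) ℂ) m (fun _ _ => rfl) p q

theorem blockMatrix_diagonal_levelOneResidualKernel
    (h : ∀ ℓ < 3, Coarsening (N ℓ) (N (ℓ + 1)) (m ℓ)) :
    blockMatrix (N 1) (N 1) (fun p q => Matrix.diagonal (levelOneResidualKernel m lam p q)) =
      (diagonalizedPropagator m N lam)ᵀ.submatrix (Fin.revPerm.prodCongr (Equiv.refl _))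
        (Fin.revPerm.prodCongr (Equiv.refl _)) := by
  have hcard := coarsening_card h
  have hrev (p : Fin (N 1)) : (p.rev : ℕ) = m 1 * (m 2 * (N 3 - 1)) - p := by
    rw [Fin.val_rev]; omega
  ext ⟨p, a⟩ ⟨q, b⟩
  rw [diagonalizedPropagator_eq h]
  simp only [blockMatrix_apply, Matrix.submatrix_apply, Matrix.transpose_apply,
    Equiv.prodCongr_apply, Prod.map, Fin.revPerm_apply, Equiv.refl_apply, hrev]
  rw [levelOneResidualKernel_eq_sub_sub lam (h 1 (by omega)).factor_pos (h 2 (by omega)).factor_pos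
    (K := N 3 - 1) (by omega) (by omega), ← Matrix.transpose_apply (Matrix.diagonal _) a b,
    Matrix.diagonal_transpose]

theorem absColSum_diagonalizedPropagator (h : ∀ ℓ < 3, Coarsening (N ℓ) (N (ℓ + 1)) (m ℓ))
    (q : Fin (N 1)) (k : Fin Nx) :
    absColSum (diagonalizedPropagator m N lam) (q, k) =
      ∑ p ∈ Finset.range (N 1), ‖levelOneErrorKernel m (fun ℓ => lam ℓ k) p q‖ := by
  rw [diagonalizedPropagator_eq h, absColSum, Fintype.sum_prod_type,
    ← Fin.sum_univ_eq_sum_range fun p => ‖levelOneErrorKernel m (fun ℓ => lam ℓ k) p q‖]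
  refine Finset.sum_congr rfl fun p _ => ?_
  rw [Fintype.sum_eq_single k fun k' hk => ?_]
  · rw [blockMatrix_apply, Matrix.diagonal_apply_eq, levelOneErrorKernel_apply]
  · rw [blockMatrix_apply, Matrix.diagonal_apply_ne _ hk, norm_zero]

theorem absRowSum_diagonalizedPropagator (h : ∀ ℓ < 3, Coarsening (N ℓ) (N (ℓ + 1)) (m ℓ))
    (p : Fin (N 1)) (k : Fin Nx) :
    absRowSum (diagonalizedPropagator m N lam) (p, k) =
      ∑ q ∈ Finset.range (N 1), ‖levelOneErrorKernel m (fun ℓ => lam ℓ k) p q‖ := by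
  rw [diagonalizedPropagator_eq h, absRowSum, Fintype.sum_prod_type,
    ← Fin.sum_univ_eq_sum_range fun q => ‖levelOneErrorKernel m (fun ℓ => lam ℓ k) p q‖]
  refine Finset.sum_congr rfl fun q _ => ?_
  rw [Fintype.sum_eq_single k fun k' hk => ?_]
  · rw [blockMatrix_apply, Matrix.diagonal_apply_eq, levelOneErrorKernel_apply]
  · rw [blockMatrix_apply, Matrix.diagonal_apply_ne' _ hk, norm_zero]

theorem norm2_residual_succ_le (h : ∀ ℓ < 3, Coarsening (N ℓ) (N (ℓ + 1)) (m ℓ))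
    {Φ : ℕ → SpaceOp Nx} {X : SpaceOp Nx} (hX : X ∈ Matrix.unitaryGroup (Fin Nx) ℂ)
    (hΦ : ∀ ℓ < 4, Φ ℓ = X * Matrix.diagonal (lam ℓ) * Xᴴ) {g u₀ : STVec (N 0) Nx} {i : ℕ}
    (hi : 1 ≤ i ∨ FRelaxedStart m N Φ g u₀) :
    norm2 (residual m N Φ g u₀ (i + 1)) ≤
      √(matNorm1 (diagonalizedPropagator m N lam) *
        matNormInf (diagonalizedPropagator m N lam)) * norm2 (residual m N Φ g u₀ i) := by
  have h₀ := h 0 (by omega)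
  obtain ⟨w, hw⟩ := exists_residual_eq_transpose_mulVec h hi
  have hRw : Rmat m N Φ 0 *ᵥ ((RImat Nx m N 0)ᵀ *ᵥ w) = w := by
    rw [Matrix.mulVec_mulVec, Rmat, RImat, restriction_mul_injection_transpose h₀,
      Matrix.one_mulVec]
  have hconj (p q : ℕ) : levelOneResidualKernel m Φ p q =
      X * Matrix.diagonal (levelOneResidualKernel m lam p q) * Xᴴ :=
    levelOneResidualKernel_map (spectralHom ⟨X, hX⟩) m hΦ p q
  have hschur := norm2_blockMatrix_conj_mulVec_le (n := N 1) hX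
    (fun p q => Matrix.diagonal (levelOneResidualKernel m lam p q)) w
  rw [blockMatrix_diagonal_levelOneResidualKernel h, matNorm1_submatrix,
    matNormInf_submatrix] at hschur
  rw [residual_succ Φ h, hw, hRw, RImat, norm2_injection_transpose_mulVec h₀,
    norm2_injection_transpose_mulVec h₀, funext₂ hconj, mul_comm (matNorm1 _)]
  exact hschur

theorem convergenceFactor_le (h : ∀ ℓ < 3, Coarsening (N ℓ) (N (ℓ + 1)) (m ℓ))
    {Φ : ℕ → SpaceOp Nx} {X : SpaceOp Nx} (hX : X ∈ Matrix.unitaryGroup (Fin Nx) ℂ)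
    (hΦ : ∀ ℓ < 4, Φ ℓ = X * Matrix.diagonal (lam ℓ) * Xᴴ) :
    convergenceFactor m N Φ ≤ ENNReal.ofReal
      (√(matNorm1 (diagonalizedPropagator m N lam) *
        matNormInf (diagonalizedPropagator m N lam))) := by
  refine iSup_le fun g => iSup_le fun u₀ => iSup_le fun i => iSup_le fun hi => ?_
  refine ENNReal.div_le_of_le_mul ?_
  rw [← ENNReal.ofReal_mul (Real.sqrt_nonneg _)]
  exact ENNReal.ofReal_le_ofReal (norm2_residual_succ_le h hX hΦ hi)

end Diagonalization

section GeometricSums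

/-- The geometric sum `1 + x + ⋯ + x ^ (n - 1)`; unlike the closed form `geo x n`, it needs no
exception at `x = 1`. -/
def geomSum (x : ℝ) (n : ℕ) : ℝ := ∑ i ∈ Finset.range n, x ^ i

theorem geo_eq_geomSum {x : ℝ} (hx : x ≠ 1) (n : ℕ) : geo x n = geomSum x n := by
  rw [geo, geomSum, div_eq_iff (sub_ne_zero.2 hx.symm), geom_sum_mul_neg]

@[simp]
theorem geomSum_zero (x : ℝ) : geomSum x 0 = 0 := by simp [geomSum]

theorem sum_range_ite_pow_sub {m j : ℕ} (hj : j ≤ m) (x : ℝ) (c : Prop) [Decidable c] :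
    (∑ i ∈ Finset.range m, if c ∧ m ≤ i + j then x ^ (i + j - m) else 0) =
      if c then geomSum x j else 0 := by
  obtain ⟨e, rfl⟩ := Nat.exists_eq_add_of_le' hj
  have hlow : ∀ i ∈ Finset.range e,
      (if c ∧ e + j ≤ i + j then x ^ (i + j - (e + j)) else 0) = 0 := fun i hi =>
    if_neg fun h => by have := Finset.mem_range.1 hi; omega
  rw [Finset.sum_range_add, Finset.sum_eq_zero hlow, zero_add]
  by_cases hc : c
  · rw [if_pos hc]
    refine Finset.sum_congr rfl fun i _ => ?_
    rw [if_pos ⟨hc, by omega⟩]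
    congr 1
    omega
  · simp [hc]

theorem sum_range_mul (m K : ℕ) (f : ℕ → ℝ) :
    ∑ p ∈ Finset.range (m * K), f p =
      ∑ P ∈ Finset.range K, ∑ i ∈ Finset.range m, f (m * P + i) := by
  induction K with
  | zero => simp
  | succ K ih => rw [Nat.mul_succ, Finset.sum_range_add, ih, Finset.sum_range_succ]

theorem sum_range_mul_reflect (m K : ℕ) (f : ℕ → ℝ) :
    ∑ q ∈ Finset.range (m * K), f q =
      ∑ C ∈ Finset.range K, ∑ j ∈ Finset.range m, f (m * C + (m - 1 - j)) := by
  rw [sum_range_mul]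
  exact Finset.sum_congr rfl fun C _ => (Finset.sum_range_reflect (fun i => f (m * C + i)) m).symm

end GeometricSums

section Norms

variable {𝕜 : Type*} [NormedDivisionRing 𝕜] {κ : ℕ → ℕ → 𝕜}

theorem norm_errKernel_invKernel (μ l : 𝕜) (p q : ℕ) :
    ‖errKernel μ (invKernel l) p q‖ = ‖μ - l‖ * ‖invKernel l p (q + 1)‖ := by
  rw [errKernel_invKernel, norm_mul, mul_comm]

theorem norm_cycleKernel {m i j P q C : ℕ} (hκ : UnitLower κ) (hi : i < m) (hj : j < m)
    (h : q + j = m * C) (l : 𝕜) :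
    ‖cycleKernel m l κ (m * P + i) q‖ =
      (if C = P + 1 ∧ m ≤ i + j then ‖l‖ ^ (i + j - m) else 0) +
        ‖l‖ ^ i * (‖l‖ ^ j * ‖κ P C‖) := by
  rw [cycleKernel_apply hi hj h]
  split_ifs with hC
  · simp [hC.1, hκ.eq_zero_of_lt P.lt_succ_self]
  · simp [mul_assoc, mul_comm (‖l‖ ^ j)]

theorem norm_errKernel_cycleKernel_of_lt {m j C q : ℕ} (hj : j + 1 < m) (h : q + 1 + j = m * C)
    (μ l : 𝕜) (κ : ℕ → ℕ → 𝕜) (p : ℕ) :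
    ‖errKernel μ (cycleKernel m l κ) p q‖ = ‖μ - l‖ * ‖cycleKernel m l κ p (q + 1)‖ := by
  rw [errKernel_cycleKernel_of_lt hj h, norm_mul, mul_comm]

theorem norm_errKernel_cycleKernel_mul {m i : ℕ} (hκ : UnitLower κ) (hi : i < m) (μ l : 𝕜)
    (P C : ℕ) :
    ‖errKernel μ (cycleKernel m l κ) (m * P + i) (m * C)‖ =
      ‖μ - l‖ * (if C = P ∧ 0 < i then ‖l‖ ^ (i - 1) else 0) +
        ‖l‖ ^ i * ‖errKernel (l ^ (m - 1) * μ) κ P C‖ := by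
  rw [errKernel_cycleKernel_mul hi]
  split_ifs with hC
  · simp [errKernel_of_le hκ _ hC.1.ge, mul_comm]
  · simp

end Norms

section ColumnSums

variable {𝕜 : Type*} [NormedDivisionRing 𝕜] {κ : ℕ → ℕ → 𝕜}

/-- The absolute sum of column `q` over the rows `p ≤ K`, where every row but the last one has
weight `a`: interpolation copies a row to all points of its interval, and the interval of the last
point consists of that point alone. -/
def colWeight (a : ℝ) (κ : ℕ → ℕ → 𝕜) (K q : ℕ) : ℝ :=
  a * ∑ p ∈ Finset.range K, ‖κ p q‖ + ‖κ K q‖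

theorem colWeight_invKernel (a : ℝ) (l : 𝕜) {K q : ℕ} (h : q ≤ K) :
    colWeight a (invKernel l) K q = a * geomSum ‖l‖ (K - q) + ‖l‖ ^ (K - q) := by
  obtain ⟨d, rfl⟩ := Nat.exists_eq_add_of_le h
  have hlow : ∀ p ∈ Finset.range q, ‖invKernel l p q‖ = 0 := fun p hp => by
    rw [invKernel_of_lt l (Finset.mem_range.1 hp), norm_zero]
  rw [colWeight, Finset.sum_range_add, Finset.sum_eq_zero hlow]
  simp [invKernel, geomSum]

theorem colWeight_cycleKernel {m j q C K : ℕ} (hκ : UnitLower κ) (hj : j < m) (h : q + j = m * C)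
    (hC : C ≤ K) (a : ℝ) (l : 𝕜) :
    colWeight a (cycleKernel m l κ) (m * K) q =
      a * geomSum ‖l‖ j + ‖l‖ ^ j * colWeight (a * geomSum ‖l‖ m) κ K C := by
  have hrelax : (∑ P ∈ Finset.range K, if C = P + 1 then geomSum ‖l‖ j else 0) =
      geomSum ‖l‖ j := by
    cases C with
    | zero => simp [show j = 0 by omega]
    | succ C => simp [Nat.lt_of_succ_le hC]
  have hsum : ∑ p ∈ Finset.range (m * K), ‖cycleKernel m l κ p q‖ = geomSum ‖l‖ j +
      geomSum ‖l‖ m * (‖l‖ ^ j * ∑ P ∈ Finset.range K, ‖κ P C‖) := by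
    rw [sum_range_mul, ← hrelax, Finset.mul_sum, Finset.mul_sum, ← Finset.sum_add_distrib]
    refine Finset.sum_congr rfl fun P _ => ?_
    rw [← sum_range_ite_pow_sub hj.le, geomSum, Finset.sum_mul, ← Finset.sum_add_distrib]
    exact Finset.sum_congr rfl fun i hi => norm_cycleKernel hκ (Finset.mem_range.1 hi) hj h l
  have hlast : ‖cycleKernel m l κ (m * K) q‖ = ‖l‖ ^ j * ‖κ K C‖ := by
    have := norm_cycleKernel (P := K) hκ (Nat.zero_lt_of_lt hj) hj h l
    rwa [if_neg (by omega), pow_zero, one_mul, zero_add, add_zero] at this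
  rw [colWeight, colWeight, hsum, hlast]
  ring

theorem colWeight_errKernel_invKernel (a : ℝ) (μ l : 𝕜) (K q : ℕ) :
    colWeight a (errKernel μ (invKernel l)) K q =
      ‖μ - l‖ * colWeight a (invKernel l) K (q + 1) := by
  simp only [colWeight, norm_errKernel_invKernel, ← Finset.mul_sum]
  ring

theorem colWeight_errKernel_cycleKernel_of_lt {m j C q : ℕ} (hj : j + 1 < m)
    (h : q + 1 + j = m * C) (a : ℝ) (μ l : 𝕜) (κ : ℕ → ℕ → 𝕜) (K : ℕ) :
    colWeight a (errKernel μ (cycleKernel m l κ)) K q =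
      ‖μ - l‖ * colWeight a (cycleKernel m l κ) K (q + 1) := by
  simp only [colWeight, norm_errKernel_cycleKernel_of_lt hj h, ← Finset.mul_sum]
  ring

theorem colWeight_errKernel_cycleKernel_mul {m C K : ℕ} (hκ : UnitLower κ) (hm : 0 < m)
    (hC : C < K) (a : ℝ) (μ l : 𝕜) :
    colWeight a (errKernel μ (cycleKernel m l κ)) (m * K) (m * C) =
      a * (‖μ - l‖ * geomSum ‖l‖ (m - 1)) +
        colWeight (a * geomSum ‖l‖ m) (errKernel (l ^ (m - 1) * μ) κ) K C := by
  have hrelax : (∑ P ∈ Finset.range K, if C = P then geomSum ‖l‖ (m - 1) else 0) =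
      geomSum ‖l‖ (m - 1) := by simp [hC]
  have hsum : ∑ p ∈ Finset.range (m * K), ‖errKernel μ (cycleKernel m l κ) p (m * C)‖ =
      ‖μ - l‖ * geomSum ‖l‖ (m - 1) +
        geomSum ‖l‖ m * ∑ P ∈ Finset.range K, ‖errKernel (l ^ (m - 1) * μ) κ P C‖ := by
    rw [sum_range_mul, ← hrelax, Finset.mul_sum, Finset.mul_sum, ← Finset.sum_add_distrib]
    refine Finset.sum_congr rfl fun P _ => ?_
    rw [← sum_range_ite_pow_sub (Nat.sub_le m 1), geomSum, Finset.sum_mul, Finset.mul_sum,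
      ← Finset.sum_add_distrib]
    refine Finset.sum_congr rfl fun i hi => ?_
    rw [norm_errKernel_cycleKernel_mul hκ (Finset.mem_range.1 hi),
      show i + (m - 1) - m = i - 1 by omega]
    congr 2
    exact if_congr (by omega) rfl rfl
  have hlast : ‖errKernel μ (cycleKernel m l κ) (m * K) (m * C)‖ =
      ‖errKernel (l ^ (m - 1) * μ) κ K C‖ := by
    simpa using norm_errKernel_cycleKernel_mul hκ hm μ l K C
  rw [colWeight, colWeight, hsum, hlast]
  ring

end ColumnSums

section RowSums

variable {𝕜 : Type*} [NormedDivisionRing 𝕜] {κ : ℕ → ℕ → 𝕜}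

theorem sum_norm_invKernel (l : 𝕜) {P K : ℕ} (h : P ≤ K) :
    ∑ q ∈ Finset.range K, ‖invKernel l P (q + 1)‖ = geomSum ‖l‖ P := by
  obtain ⟨d, rfl⟩ := Nat.exists_eq_add_of_le h
  have hhigh : ∀ q ∈ Finset.range d, ‖invKernel l P (P + q + 1)‖ = 0 := fun q _ => by
    rw [invKernel_of_lt l (by omega), norm_zero]
  rw [Finset.sum_range_add, Finset.sum_eq_zero hhigh, add_zero, geomSum,
    ← Finset.sum_range_reflect]
  refine Finset.sum_congr rfl fun q hq => ?_
  have hqP := Finset.mem_range.1 hq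
  rw [invKernel, if_pos (by omega), norm_pow, show P - (P - 1 - q + 1) = q by omega]

theorem sum_range_ite_geomSum {m i P K : ℕ} (hp : m * P + i ≤ m * K) (hi : i < m) (x : ℝ) :
    (∑ C ∈ Finset.range K, if C = P then geomSum x i else 0) = geomSum x i := by
  rcases Nat.eq_zero_or_pos i with rfl | hi0
  · simp
  · have hPK : P < K := Nat.lt_of_mul_lt_mul_left (a := m) (by omega)
    simp [hPK]

theorem sum_norm_cycleKernel {m i P K : ℕ} (hκ : UnitLower κ) (hi : i < m)
    (hp : m * P + i ≤ m * K) (l : 𝕜) :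
    ∑ q ∈ Finset.range (m * K), ‖cycleKernel m l κ (m * P + i) (q + 1)‖ = geomSum ‖l‖ i +
      ‖l‖ ^ i * (geomSum ‖l‖ m * ∑ C ∈ Finset.range K, ‖κ P (C + 1)‖) := by
  rw [sum_range_mul_reflect, ← sum_range_ite_geomSum hp hi, Finset.mul_sum, Finset.mul_sum,
    ← Finset.sum_add_distrib]
  refine Finset.sum_congr rfl fun C _ => ?_
  rw [← sum_range_ite_pow_sub hi.le, geomSum, Finset.sum_mul, Finset.mul_sum,
    ← Finset.sum_add_distrib]
  refine Finset.sum_congr rfl fun j hj => ?_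
  have hjm := Finset.mem_range.1 hj
  rw [norm_cycleKernel hκ hi hjm (by rw [Nat.mul_succ]; omega : _ = m * (C + 1)), add_comm i j]
  simp only [Nat.add_right_cancel_iff]

theorem norm_errKernel_cycleKernel {m i j : ℕ} (hκ : UnitLower κ) (hi : i < m) (hj : j < m)
    (μ l : 𝕜) (P C : ℕ) :
    ‖errKernel μ (cycleKernel m l κ) (m * P + i) (m * C + (m - 1 - j))‖ =
      ‖μ - l‖ * (if C = P ∧ m ≤ j + i then ‖l‖ ^ (j + i - m) else 0) +
        ‖l‖ ^ i * if j = m - 1 then ‖errKernel (l ^ (m - 1) * μ) κ P C‖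
          else ‖l‖ ^ j * (‖μ - l‖ * ‖κ P (C + 1)‖) := by
  by_cases hjm : j = m - 1
  · subst hjm
    rw [Nat.sub_self, add_zero, norm_errKernel_cycleKernel_mul hκ hi, if_pos rfl,
      show m - 1 + i - m = i - 1 by omega]
    congr 2
    exact if_congr (by omega) rfl rfl
  · have h : m * C + (m - 1 - j) + 1 + j = m * (C + 1) := by rw [Nat.mul_succ]; omega
    rw [norm_errKernel_cycleKernel_of_lt (by omega) h, norm_cycleKernel hκ hi hj h, if_neg hjm,
      add_comm i j]
    simp only [Nat.add_right_cancel_iff]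
    ring

theorem sum_norm_errKernel_cycleKernel {m i P K : ℕ} (hκ : UnitLower κ) (hi : i < m)
    (hp : m * P + i ≤ m * K) (μ l : 𝕜) :
    ∑ q ∈ Finset.range (m * K), ‖errKernel μ (cycleKernel m l κ) (m * P + i) q‖ =
      ‖μ - l‖ * geomSum ‖l‖ i +
        ‖l‖ ^ i * (‖μ - l‖ * geomSum ‖l‖ (m - 1) * ∑ C ∈ Finset.range K, ‖κ P (C + 1)‖ +
          ∑ C ∈ Finset.range K, ‖errKernel (l ^ (m - 1) * μ) κ P C‖) := by
  rw [sum_range_mul_reflect, ← sum_range_ite_geomSum hp hi, Finset.mul_sum, Finset.mul_sum,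
    ← Finset.sum_add_distrib, Finset.mul_sum, ← Finset.sum_add_distrib]
  refine Finset.sum_congr rfl fun C _ => ?_
  have hcoarse : (∑ j ∈ Finset.range m, if j = m - 1 then ‖errKernel (l ^ (m - 1) * μ) κ P C‖
        else ‖l‖ ^ j * (‖μ - l‖ * ‖κ P (C + 1)‖)) =
      ‖μ - l‖ * geomSum ‖l‖ (m - 1) * ‖κ P (C + 1)‖ + ‖errKernel (l ^ (m - 1) * μ) κ P C‖ := by
    obtain ⟨n, rfl⟩ := Nat.exists_eq_add_one_of_ne_zero (Nat.ne_zero_of_lt hi)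
    rw [Finset.sum_range_succ, if_pos (Nat.add_sub_cancel n 1).symm, Nat.add_sub_cancel,
      Finset.sum_congr rfl fun j hj => if_neg (Finset.mem_range.1 hj).ne, ← Finset.sum_mul,
      ← geomSum]
    ring
  rw [← hcoarse, ← sum_range_ite_pow_sub hi.le, Finset.mul_sum, Finset.mul_sum,
    ← Finset.sum_add_distrib]
  exact Finset.sum_congr rfl fun j hj =>
    norm_errKernel_cycleKernel hκ hi (Finset.mem_range.1 hj) μ l P C

end RowSums

section Weights

variable (m0 m1 m2 : ℕ) (l0 l1 l2 l3 : ℂ)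

theorem norm_sub_eq_w1 : ‖l0 ^ m0 - l1‖ = w1 m0 l0 l1 := norm_sub_rev _ _

theorem norm_sub_eq_w2 : ‖l1 ^ (m1 - 1) * l0 ^ m0 - l2‖ = w2 m0 m1 l0 l1 l2 := by
  rw [norm_sub_rev, mul_comm, w2]

theorem norm_sub_eq_w3 :
    ‖l2 ^ (m2 - 1) * (l1 ^ (m1 - 1) * l0 ^ m0) - l3‖ = w3 m0 m1 m2 l0 l1 l2 l3 := by
  rw [norm_sub_rev, mul_comm, mul_comm (l1 ^ _), w3]

end Weights

section LevelOneColumnSums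

variable {m : ℕ → ℕ} {l : ℕ → ℂ} {N3 : ℕ}

theorem sum_norm_levelOneErrorKernel_col (m : ℕ → ℕ) (l : ℕ → ℂ) (K q : ℕ) :
    ∑ p ∈ Finset.range (m 1 * (m 2 * K) + 1), ‖levelOneErrorKernel m l p q‖ =
      colWeight 1 (errKernel (l 0 ^ m 0)
        (cycleKernel (m 1) (l 1) (cycleKernel (m 2) (l 2) (invKernel (l 3)))))
        (m 1 * (m 2 * K)) q := by
  rw [Finset.sum_range_succ, colWeight, one_mul]
  rfl

theorem sum_norm_levelOneErrorKernel_col_zero (hm1 : 0 < m 1) (hm2 : 0 < m 2) (h1 : ‖l 1‖ ≠ 1)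
    (h2 : ‖l 2‖ ≠ 1) (h3 : ‖l 3‖ ≠ 1) (hN3 : 2 ≤ N3) :
    ∑ p ∈ Finset.range (m 1 * (m 2 * (N3 - 1)) + 1), ‖levelOneErrorKernel m l p 0‖ =
      colFirst (m 0) (m 1) (m 2) N3 (l 0) (l 1) (l 2) (l 3) := by
  have hK : 0 < N3 - 1 := by omega
  have hinv := unitLower_invKernel (l 3)
  have hlevel1 := colWeight_errKernel_cycleKernel_mul (hinv.cycleKernel hm2 (l 2)) hm1
    (Nat.mul_pos hm2 hK) 1 (l 0 ^ m 0) (l 1)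
  have hlevel2 := colWeight_errKernel_cycleKernel_mul hinv hm2 hK (1 * geomSum ‖l 1‖ (m 1))
    (l 1 ^ (m 1 - 1) * l 0 ^ m 0) (l 2)
  rw [mul_zero] at hlevel1 hlevel2
  rw [sum_norm_levelOneErrorKernel_col, hlevel1, hlevel2, colWeight_errKernel_invKernel,
    colWeight_invKernel _ _ hK, norm_sub_eq_w1, norm_sub_eq_w2, norm_sub_eq_w3]
  simp only [colFirst, geo_eq_geomSum h1, geo_eq_geomSum h2, geo_eq_geomSum h3, Nat.sub_sub]
  ring

theorem sum_norm_levelOneErrorKernel_col_C (hm1 : 0 < m 1) (h1 : ‖l 1‖ ≠ 1) (h2 : ‖l 2‖ ≠ 1)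
    (h3 : ‖l 3‖ ≠ 1) (hN3 : 2 ≤ N3) {j : ℕ} (hj : 0 < j) (hj' : j < m 2) :
    ∑ p ∈ Finset.range (m 1 * (m 2 * (N3 - 1)) + 1),
        ‖levelOneErrorKernel m l p (m 1 * (m 2 - j))‖ =
      colC (m 0) (m 1) (m 2) N3 (l 0) (l 1) (l 2) (l 3) j := by
  have hK : 1 ≤ N3 - 1 := by omega
  have hm2 : 0 < m 2 := hj.trans hj'
  have hinv := unitLower_invKernel (l 3)
  have hC : m 2 - j < m 2 * (N3 - 1) :=
    (Nat.sub_lt hm2 hj).trans_le (Nat.le_mul_of_pos_right _ hK)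
  have hindex : m 2 - j + 1 + (j - 1) = m 2 * 1 := by omega
  rw [sum_norm_levelOneErrorKernel_col,
    colWeight_errKernel_cycleKernel_mul (hinv.cycleKernel hm2 (l 2)) hm1 hC,
    colWeight_errKernel_cycleKernel_of_lt (by omega) hindex,
    colWeight_cycleKernel hinv (by omega) hindex hK, colWeight_invKernel _ _ hK,
    norm_sub_eq_w1, norm_sub_eq_w2]
  simp only [colC, geo_eq_geomSum h1, geo_eq_geomSum h2, geo_eq_geomSum h3, Nat.sub_sub, geomSum]
  ring

theorem sum_norm_levelOneErrorKernel_col_F (h1 : ‖l 1‖ ≠ 1) (h2 : ‖l 2‖ ≠ 1) (h3 : ‖l 3‖ ≠ 1)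
    (hN3 : 2 ≤ N3) {j r : ℕ} (hj : j < m 2) (hr : r + 2 ≤ m 1) :
    ∑ p ∈ Finset.range (m 1 * (m 2 * (N3 - 1)) + 1),
        ‖levelOneErrorKernel m l p (m 1 * (m 2 - j) - r - 1)‖ =
      colF (m 0) (m 1) (m 2) N3 (l 0) (l 1) (l 2) (l 3) j r := by
  have hK : 1 ≤ N3 - 1 := by omega
  have hm2 : 0 < m 2 := Nat.zero_lt_of_lt hj
  have hinv := unitLower_invKernel (l 3)
  have hC : m 2 - j ≤ m 2 * (N3 - 1) := (Nat.sub_le _ _).trans (Nat.le_mul_of_pos_right _ hK)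
  have hindex : m 1 * (m 2 - j) - r - 1 + 1 + r = m 1 * (m 2 - j) := by
    have := Nat.le_mul_of_pos_right (m 1) (Nat.sub_pos_of_lt hj)
    omega
  rw [sum_norm_levelOneErrorKernel_col,
    colWeight_errKernel_cycleKernel_of_lt (by omega) hindex,
    colWeight_cycleKernel (hinv.cycleKernel hm2 (l 2)) (by omega) hindex hC,
    colWeight_cycleKernel hinv hj (by omega : m 2 - j + j = m 2 * 1) hK,
    colWeight_invKernel _ _ hK, norm_sub_eq_w1]
  simp only [colF, geo_eq_geomSum h1, geo_eq_geomSum h2, geo_eq_geomSum h3, Nat.sub_sub, geomSum]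
  ring

theorem sum_norm_levelOneErrorKernel_eq_sCol (hm1 : 0 < m 1) (hm2 : 0 < m 2) (h1 : ‖l 1‖ ≠ 1)
    (h2 : ‖l 2‖ ≠ 1) (h3 : ‖l 3‖ ≠ 1) (hN3 : 2 ≤ N3) {d : ℕ} (hd : d < m 1 * m 2) :
    ∑ p ∈ Finset.range (m 1 * (m 2 * (N3 - 1)) + 1), ‖levelOneErrorKernel m l p d‖ =
      sCol (m 0) (m 1) (m 2) N3 (l 0) (l 1) (l 2) (l 3) d := by
  obtain ⟨C, i, hi, hdC⟩ := exists_add_eq_mul hm1 d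
  have hC : C < m 2 + 1 := Nat.lt_of_mul_lt_mul_left (a := m 1) (by rw [Nat.mul_succ]; omega)
  obtain ⟨j, rfl⟩ : ∃ j, C = m 2 - j := ⟨m 2 - C, by omega⟩
  rcases le_or_gt (m 2) j with hj | hj
  · obtain rfl : d = 0 := by rw [Nat.sub_eq_zero_of_le hj] at hdC; omega
    rw [sCol_zero, sum_norm_levelOneErrorKernel_col_zero hm1 hm2 h1 h2 h3 hN3]
  rcases i with _ | r
  · obtain rfl : d = m 1 * (m 2 - j) := hdC
    have hj0 : 0 < j := Nat.pos_of_ne_zero fun h => by simp [h] at hd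
    rw [sCol_C _ _ _ _ _ _ _ _ hm1 j hj0 (by omega),
      sum_norm_levelOneErrorKernel_col_C hm1 h1 h2 h3 hN3 hj0 hj]
  · obtain rfl : d = m 1 * (m 2 - j) - r - 1 := by omega
    rw [sCol_F _ _ _ _ _ _ _ _ j r hj hi, sum_norm_levelOneErrorKernel_col_F h1 h2 h3 hN3 hj hi]

end LevelOneColumnSums

section LevelOneRowSums

variable {m : ℕ → ℕ} {l : ℕ → ℂ} {N3 : ℕ}

theorem sum_norm_levelOneErrorKernel_row (l : ℕ → ℂ) {K P j i : ℕ} (hj : j < m 2) (hi : i < m 1)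
    (hp : m 1 * (m 2 * P + j) + i ≤ m 1 * (m 2 * K)) :
    ∑ q ∈ Finset.range (m 1 * (m 2 * K)),
        ‖levelOneErrorKernel m l (m 1 * (m 2 * P + j) + i) q‖ =
      w1 (m 0) (l 0) (l 1) * geomSum ‖l 1‖ i + ‖l 1‖ ^ i *
        (w1 (m 0) (l 0) (l 1) * geomSum ‖l 1‖ (m 1 - 1) *
            (geomSum ‖l 2‖ j + ‖l 2‖ ^ j * (geomSum ‖l 2‖ (m 2) * geomSum ‖l 3‖ P)) +
          (w2 (m 0) (m 1) (l 0) (l 1) (l 2) * geomSum ‖l 2‖ j + ‖l 2‖ ^ j *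
            (w2 (m 0) (m 1) (l 0) (l 1) (l 2) * geomSum ‖l 2‖ (m 2 - 1) * geomSum ‖l 3‖ P +
              w3 (m 0) (m 1) (m 2) (l 0) (l 1) (l 2) (l 3) * geomSum ‖l 3‖ P))) := by
  have hm2 : 0 < m 2 := Nat.zero_lt_of_lt hj
  have hinv := unitLower_invKernel (l 3)
  have hlevel2 : m 2 * P + j ≤ m 2 * K :=
    le_of_mul_le_mul_left (by omega : m 1 * (m 2 * P + j) ≤ _) (Nat.zero_lt_of_lt hi)
  have hlevel3 : P ≤ K := le_of_mul_le_mul_left (by omega : m 2 * P ≤ _) hm2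
  change ∑ q ∈ Finset.range _, ‖errKernel (l 0 ^ m 0)
    (cycleKernel (m 1) (l 1) (cycleKernel (m 2) (l 2) (invKernel (l 3)))) _ q‖ = _
  rw [sum_norm_errKernel_cycleKernel (hinv.cycleKernel hm2 (l 2)) hi hp,
    sum_norm_errKernel_cycleKernel hinv hj hlevel2, sum_norm_cycleKernel hinv hj hlevel2]
  simp only [norm_errKernel_invKernel]
  rw [← Finset.mul_sum, sum_norm_invKernel _ hlevel3, norm_sub_eq_w1, norm_sub_eq_w2,
    norm_sub_eq_w3]

theorem sum_norm_levelOneErrorKernel_row_last (hm1 : 0 < m 1) (hm2 : 0 < m 2) (h1 : ‖l 1‖ ≠ 1)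
    (h2 : ‖l 2‖ ≠ 1) (h3 : ‖l 3‖ ≠ 1) :
    ∑ q ∈ Finset.range (m 1 * (m 2 * (N3 - 1))),
        ‖levelOneErrorKernel m l (m 1 * (m 2 * (N3 - 1))) q‖ =
      rowLast (m 0) (m 1) (m 2) N3 (l 0) (l 1) (l 2) (l 3) := by
  have hrow := sum_norm_levelOneErrorKernel_row l (P := N3 - 1) (K := N3 - 1) hm2 hm1 le_rfl
  rw [add_zero, add_zero] at hrow
  rw [hrow]
  simp only [rowLast, geo_eq_geomSum h1, geo_eq_geomSum h2, geo_eq_geomSum h3, geomSum_zero]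
  ring

theorem sum_norm_levelOneErrorKernel_row_C (hm1 : 0 < m 1) (h1 : ‖l 1‖ ≠ 1) (h2 : ‖l 2‖ ≠ 1)
    (h3 : ‖l 3‖ ≠ 1) (hN3 : 2 ≤ N3) {j : ℕ} (hj : j < m 2) :
    ∑ q ∈ Finset.range (m 1 * (m 2 * (N3 - 1))),
        ‖levelOneErrorKernel m l (m 1 * (m 2 * (N3 - 2) + j)) q‖ =
      rowC (m 0) (m 1) (m 2) N3 (l 0) (l 1) (l 2) (l 3) j := by
  have hp : m 2 * (N3 - 2) + j ≤ m 2 * (N3 - 1) := by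
    rw [show N3 - 1 = N3 - 2 + 1 by omega, Nat.mul_succ]; omega
  have hrow := sum_norm_levelOneErrorKernel_row l (P := N3 - 2) (K := N3 - 1) hj hm1
    (Nat.mul_le_mul_left _ hp)
  rw [add_zero] at hrow
  rw [hrow]
  simp only [rowC, geo_eq_geomSum h1, geo_eq_geomSum h2, geo_eq_geomSum h3, geomSum_zero]
  ring

theorem sum_norm_levelOneErrorKernel_row_F (h1 : ‖l 1‖ ≠ 1) (h2 : ‖l 2‖ ≠ 1) (h3 : ‖l 3‖ ≠ 1)
    (hN3 : 2 ≤ N3) {j r : ℕ} (hj : j < m 2) (hr : r < m 1) :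
    ∑ q ∈ Finset.range (m 1 * (m 2 * (N3 - 1))),
        ‖levelOneErrorKernel m l (m 1 * (m 2 * (N3 - 2) + j) + r) q‖ =
      rowF (m 0) (m 1) (m 2) N3 (l 0) (l 1) (l 2) (l 3) j r := by
  have hp : m 2 * (N3 - 2) + (j + 1) ≤ m 2 * (N3 - 1) := by
    rw [show N3 - 1 = N3 - 2 + 1 by omega, Nat.mul_succ]; omega
  rw [sum_norm_levelOneErrorKernel_row l hj hr
    (le_trans (by rw [← add_assoc, Nat.mul_succ]; omega) (Nat.mul_le_mul_left (m 1) hp))]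
  simp only [rowF, geo_eq_geomSum h1, geo_eq_geomSum h2, geo_eq_geomSum h3, geomSum]
  ring

theorem sum_norm_levelOneErrorKernel_eq_sRow (hm1 : 0 < m 1) (h1 : ‖l 1‖ ≠ 1) (h2 : ‖l 2‖ ≠ 1)
    (h3 : ‖l 3‖ ≠ 1) (hN3 : 2 ≤ N3) {p t : ℕ} (ht : 0 < t) (htM : t ≤ m 1 * m 2)
    (hp : p + m 1 * m 2 = m 1 * (m 2 * (N3 - 1)) + t) :
    ∑ q ∈ Finset.range (m 1 * (m 2 * (N3 - 1))), ‖levelOneErrorKernel m l p q‖ =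
      sRow (m 0) (m 1) (m 2) N3 (l 0) (l 1) (l 2) (l 3) t := by
  have hK : m 1 * (m 2 * (N3 - 1)) = m 1 * (m 2 * (N3 - 2)) + m 1 * m 2 := by
    rw [show N3 - 1 = N3 - 2 + 1 by omega]; ring
  rcases htM.eq_or_lt with rfl | hlt
  · have hm2 : 0 < m 2 := Nat.pos_of_mul_pos_left ht
    obtain rfl : p = m 1 * (m 2 * (N3 - 1)) := by omega
    rw [sRow_last, sum_norm_levelOneErrorKernel_row_last hm1 hm2 h1 h2 h3]
  obtain ⟨j, r, hr, rfl⟩ := exists_eq_mul_add hm1 t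
  have hj : j < m 2 := Nat.lt_of_mul_lt_mul_left (a := m 1) (by omega)
  obtain rfl : p = m 1 * (m 2 * (N3 - 2) + j) + r := by rw [Nat.mul_add]; omega
  rcases Nat.eq_zero_or_pos r with rfl | hr0
  · have hj0 : 0 < j := Nat.pos_of_ne_zero fun h => by simp [h] at ht
    rw [add_zero, add_zero, mul_comm (m 1) j, sRow_C _ _ _ _ _ _ _ _ hm1 j hj0 (by omega),
      sum_norm_levelOneErrorKernel_row_C hm1 h1 h2 h3 hN3 hj]
  · rw [add_comm (m 1 * j), mul_comm (m 1) j, sRow_F _ _ _ _ _ _ _ _ j r hr0 (by omega),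
      sum_norm_levelOneErrorKernel_row_F h1 h2 h3 hN3 hj hr]

end LevelOneRowSums

section Extremality

variable {m : ℕ → ℕ}

theorem levelOneErrorKernel_of_le (hm1 : 0 < m 1) (hm2 : 0 < m 2) (l : ℕ → ℂ) {p q : ℕ}
    (h : p ≤ q) : levelOneErrorKernel m l p q = 0 :=
  errKernel_of_le (((unitLower_invKernel (l 3)).cycleKernel hm2 (l 2)).cycleKernel hm1 (l 1)) _ h

theorem levelOneErrorKernel_add_right (hm1 : 0 < m 1) (hm2 : 0 < m 2) (l : ℕ → ℂ) (s p q : ℕ) :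
    levelOneErrorKernel m l (p + m 1 * (m 2 * s)) (q + m 1 * (m 2 * s)) =
      levelOneErrorKernel m l p q :=
  errKernel_add_right (cycleKernel_add_right hm1 (l 1) <| cycleKernel_add_right hm2 (l 2) fun p q =>
    invKernel_add_right (l 3) p q s) _ p q

theorem sum_norm_levelOneErrorKernel_col_add_le (hm1 : 0 < m 1) (hm2 : 0 < m 2) (l : ℕ → ℂ)
    (n q s : ℕ) :
    ∑ p ∈ Finset.range n, ‖levelOneErrorKernel m l p (q + m 1 * (m 2 * s))‖ ≤
      ∑ p ∈ Finset.range n, ‖levelOneErrorKernel m l p q‖ := by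
  set S := m 1 * (m 2 * s) with hS
  have hlow : ∀ p ∈ Finset.range S, ‖levelOneErrorKernel m l p (q + S)‖ = 0 := fun p hp => by
    rw [levelOneErrorKernel_of_le hm1 hm2 l (by have := Finset.mem_range.1 hp; omega), norm_zero]
  calc ∑ p ∈ Finset.range n, ‖levelOneErrorKernel m l p (q + S)‖
      ≤ ∑ p ∈ Finset.range (S + n), ‖levelOneErrorKernel m l p (q + S)‖ :=
        Finset.sum_le_sum_of_subset_of_nonneg (Finset.range_subset_range.2 (by omega))
          fun _ _ _ => norm_nonneg _
    _ = ∑ p ∈ Finset.range n, ‖levelOneErrorKernel m l p q‖ := by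
        rw [Finset.sum_range_add, Finset.sum_eq_zero hlow, zero_add]
        refine Finset.sum_congr rfl fun p _ => ?_
        rw [add_comm S p, hS, levelOneErrorKernel_add_right hm1 hm2]

theorem sum_norm_levelOneErrorKernel_row_le_add (hm1 : 0 < m 1) (hm2 : 0 < m 2) (l : ℕ → ℂ)
    {n p : ℕ} (s : ℕ) (hp : p + m 1 * (m 2 * s) ≤ n) :
    ∑ q ∈ Finset.range n, ‖levelOneErrorKernel m l p q‖ ≤
      ∑ q ∈ Finset.range n, ‖levelOneErrorKernel m l (p + m 1 * (m 2 * s)) q‖ := by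
  set S := m 1 * (m 2 * s) with hS
  obtain ⟨e, rfl⟩ : ∃ e, n = S + (p + e) := ⟨n - (p + S), by omega⟩
  have hhigh : ∑ q ∈ Finset.range (S + (p + e)), ‖levelOneErrorKernel m l p q‖ =
      ∑ q ∈ Finset.range (p + e), ‖levelOneErrorKernel m l p q‖ := by
    refine (Finset.sum_subset (Finset.range_subset_range.2 (by omega)) fun q _ hq => ?_).symm
    rw [levelOneErrorKernel_of_le hm1 hm2 l, norm_zero]
    have := mt Finset.mem_range.2 hq
    omega
  have hshift : ∀ q, ‖levelOneErrorKernel m l (p + S) (S + q)‖ = ‖levelOneErrorKernel m l p q‖ :=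
    fun q => by rw [add_comm S q, hS, levelOneErrorKernel_add_right hm1 hm2]
  rw [hhigh, Finset.sum_range_add _ S, Finset.sum_congr rfl fun q _ => hshift q]
  exact le_add_of_nonneg_left (Finset.sum_nonneg fun _ _ => norm_nonneg _)

end Extremality

section ExtremalBlocks

variable {Nx : ℕ} {m N : ℕ → ℕ} {lam : ℕ → Fin Nx → ℂ}

theorem coarsening_of_card (hm : ∀ ℓ < 3, 1 ≤ m ℓ)
    (hN : ∀ ℓ < 3, N ℓ = m ℓ * (N (ℓ + 1) - 1) + 1) (hN3 : 0 < N 3) :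
    ∀ ℓ < 3, Coarsening (N ℓ) (N (ℓ + 1)) (m ℓ) := fun ℓ hℓ =>
  { factor_pos := hm ℓ hℓ
    coarse_pos := by
      rcases Nat.lt_succ_iff_lt_or_eq.1 hℓ with h | rfl
      · rw [hN (ℓ + 1) (by omega)]
        exact Nat.succ_pos _
      · exact hN3
    fine_eq := hN ℓ hℓ }

theorem absColSum_eq_sCol (h : ∀ ℓ < 3, Coarsening (N ℓ) (N (ℓ + 1)) (m ℓ)) (hN3 : 2 ≤ N 3)
    (hlam : ∀ ℓ, 1 ≤ ℓ → ℓ < 4 → ∀ k, ‖lam ℓ k‖ ≠ 1) (k : Fin Nx) {q : Fin (N 1)}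
    (hq : (q : ℕ) < m 1 * m 2) :
    absColSum (diagonalizedPropagator m N lam) (q, k) =
      sCol (m 0) (m 1) (m 2) (N 3) (lam 0 k) (lam 1 k) (lam 2 k) (lam 3 k) q := by
  rw [absColSum_diagonalizedPropagator h, congrArg Finset.range (coarsening_card h)]
  exact sum_norm_levelOneErrorKernel_eq_sCol (l := fun ℓ => lam ℓ k) (h 1 (by omega)).factor_pos
    (h 2 (by omega)).factor_pos (hlam 1 le_rfl (by omega) k) (hlam 2 (by omega) (by omega) k)
    (hlam 3 (by omega) (by omega) k) hN3 hq

theorem absRowSum_eq_sRow (h : ∀ ℓ < 3, Coarsening (N ℓ) (N (ℓ + 1)) (m ℓ)) (hN3 : 2 ≤ N 3)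
    (hlam : ∀ ℓ, 1 ≤ ℓ → ℓ < 4 → ∀ k, ‖lam ℓ k‖ ≠ 1) (k : Fin Nx) {p : Fin (N 1)} {t : ℕ}
    (ht : 0 < t) (hp : (p : ℕ) + 1 + m 1 * m 2 = N 1 + t) :
    absRowSum (diagonalizedPropagator m N lam) (p, k) =
      sRow (m 0) (m 1) (m 2) (N 3) (lam 0 k) (lam 1 k) (lam 2 k) (lam 3 k) t := by
  have hm1 := (h 1 (by omega)).factor_pos
  have hm2 := (h 2 (by omega)).factor_pos
  have hcard := coarsening_card h
  have := p.isLt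
  rw [absRowSum_diagonalizedPropagator h, congrArg Finset.range hcard, Finset.sum_range_succ,
    levelOneErrorKernel_of_le hm1 hm2 _ (by omega), norm_zero, add_zero]
  exact sum_norm_levelOneErrorKernel_eq_sRow (l := fun ℓ => lam ℓ k) hm1
    (hlam 1 le_rfl (by omega) k) (hlam 2 (by omega) (by omega) k)
    (hlam 3 (by omega) (by omega) k) hN3 ht (by omega) (by omega)

theorem absColSum_le_absColSum_mod (h : ∀ ℓ < 3, Coarsening (N ℓ) (N (ℓ + 1)) (m ℓ))
    (q : Fin (N 1)) (k : Fin Nx) :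
    absColSum (diagonalizedPropagator m N lam) (q, k) ≤
      absColSum (diagonalizedPropagator m N lam)
        (⟨q % (m 1 * m 2), (Nat.mod_le _ _).trans_lt q.isLt⟩, k) := by
  rw [absColSum_diagonalizedPropagator h, absColSum_diagonalizedPropagator h]
  have hshift := sum_norm_levelOneErrorKernel_col_add_le (h 1 (by omega)).factor_pos
    (h 2 (by omega)).factor_pos (fun ℓ => lam ℓ k) (N 1) (q % (m 1 * m 2)) (q / (m 1 * m 2))
  rwa [← mul_assoc, Nat.mod_add_div] at hshift

theorem mul_lt_coarsening_card (h : ∀ ℓ < 3, Coarsening (N ℓ) (N (ℓ + 1)) (m ℓ)) (hN3 : 2 ≤ N 3) :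
    m 1 * m 2 < N 1 := by
  rw [coarsening_card h, ← mul_assoc]
  exact Nat.lt_succ_of_le (Nat.le_mul_of_pos_right _ (by omega))

theorem exists_absRowSum_le (h : ∀ ℓ < 3, Coarsening (N ℓ) (N (ℓ + 1)) (m ℓ)) (p : Fin (N 1))
    (k : Fin Nx) :
    ∃ (p' : Fin (N 1)) (t : Fin (m 1 * m 2)), (p' : ℕ) + 1 + m 1 * m 2 = N 1 + (t + 1) ∧
      absRowSum (diagonalizedPropagator m N lam) (p, k) ≤
        absRowSum (diagonalizedPropagator m N lam) (p', k) := by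
  have hm1 := (h 1 (by omega)).factor_pos
  have hm2 := (h 2 (by omega)).factor_pos
  have hcard := coarsening_card h
  rw [← mul_assoc] at hcard
  obtain ⟨s, e, he, hs⟩ := exists_eq_mul_add (Nat.mul_pos hm1 hm2) (N 1 - 1 - p)
  have hp := p.isLt
  refine ⟨⟨p + m 1 * m 2 * s, by omega⟩, ⟨m 1 * m 2 - 1 - e, by omega⟩, by simp only []; omega, ?_⟩
  rw [absRowSum_diagonalizedPropagator h, absRowSum_diagonalizedPropagator h]
  have hshift := sum_norm_levelOneErrorKernel_row_le_add hm1 hm2 (fun ℓ => lam ℓ k) (n := N 1)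
    (p := p) s (by rw [← mul_assoc]; omega)
  rwa [← mul_assoc] at hshift

theorem matNorm1_eq_iSup_sCol [NeZero Nx] (h : ∀ ℓ < 3, Coarsening (N ℓ) (N (ℓ + 1)) (m ℓ))
    (hN3 : 2 ≤ N 3) (hlam : ∀ ℓ, 1 ≤ ℓ → ℓ < 4 → ∀ k, ‖lam ℓ k‖ ≠ 1) :
    matNorm1 (diagonalizedPropagator m N lam) =
      ⨆ s : Fin Nx × Fin (m 1 * m 2), sCol (m 0) (m 1) (m 2) (N 3)
        (lam 0 s.1) (lam 1 s.1) (lam 2 s.1) (lam 3 s.1) s.2 := by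
  have hM := Nat.mul_pos (h 1 (by omega)).factor_pos (h 2 (by omega)).factor_pos
  have hMN := mul_lt_coarsening_card h hN3
  have : NeZero (m 1 * m 2) := ⟨hM.ne'⟩
  have : NeZero (N 1) := ⟨by omega⟩
  apply le_antisymm
  · refine ciSup_le fun ⟨q, k⟩ => (absColSum_le_absColSum_mod h q k).trans ?_
    rw [absColSum_eq_sCol h hN3 hlam k (Nat.mod_lt _ hM)]
    exact le_ciSup (f := fun s : Fin Nx × Fin (m 1 * m 2) => sCol (m 0) (m 1) (m 2) (N 3)
      (lam 0 s.1) (lam 1 s.1) (lam 2 s.1) (lam 3 s.1) s.2) (Set.finite_range _).bddAbove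
      (k, ⟨q % (m 1 * m 2), Nat.mod_lt _ hM⟩)
  · refine ciSup_le fun ⟨k, d⟩ => ?_
    rw [← absColSum_eq_sCol h hN3 hlam k (q := ⟨d, d.isLt.trans hMN⟩) d.isLt]
    exact absColSum_le_matNorm1 _ _

theorem matNormInf_eq_iSup_sRow [NeZero Nx] (h : ∀ ℓ < 3, Coarsening (N ℓ) (N (ℓ + 1)) (m ℓ))
    (hN3 : 2 ≤ N 3) (hlam : ∀ ℓ, 1 ≤ ℓ → ℓ < 4 → ∀ k, ‖lam ℓ k‖ ≠ 1) :
    matNormInf (diagonalizedPropagator m N lam) =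
      ⨆ s : Fin Nx × Fin (m 1 * m 2), sRow (m 0) (m 1) (m 2) (N 3)
        (lam 0 s.1) (lam 1 s.1) (lam 2 s.1) (lam 3 s.1) (s.2 + 1) := by
  have hM := Nat.mul_pos (h 1 (by omega)).factor_pos (h 2 (by omega)).factor_pos
  have hMN := mul_lt_coarsening_card h hN3
  have : NeZero (m 1 * m 2) := ⟨hM.ne'⟩
  have : NeZero (N 1) := ⟨by omega⟩
  apply le_antisymm
  · refine ciSup_le fun ⟨p, k⟩ => ?_
    obtain ⟨p', t, hp', hle⟩ := exists_absRowSum_le (lam := lam) h p k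
    rw [absRowSum_eq_sRow h hN3 hlam k (Nat.succ_pos _) hp'] at hle
    exact hle.trans (le_ciSup (f := fun s : Fin Nx × Fin (m 1 * m 2) => sRow (m 0) (m 1) (m 2)
      (N 3) (lam 0 s.1) (lam 1 s.1) (lam 2 s.1) (lam 3 s.1) (s.2 + 1))
      (Set.finite_range _).bddAbove (k, t))
  · refine ciSup_le fun ⟨k, t⟩ => ?_
    rw [← absRowSum_eq_sRow h hN3 hlam k (p := ⟨N 1 + t - m 1 * m 2, by omega⟩) (t := t + 1)
      (Nat.succ_pos _) (by simp only []; omega)]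
    exact absRowSum_le_matNormInf _ _

end ExtremalBlocks

end MGRIT

end

theorem mainTheorem5_general (Nx : ℕ) (hNx : 1 ≤ Nx) (m N : ℕ → ℕ)
    (hm : ∀ ℓ < 3, 1 ≤ m ℓ)
    (hN : ∀ ℓ < 3, N ℓ = m ℓ * (N (ℓ + 1) - 1) + 1)
    (hN3 : 2 ≤ N 3)
    (Φ : ℕ → Matrix (Fin Nx) (Fin Nx) ℂ)
    (X : Matrix (Fin Nx) (Fin Nx) ℂ) (hX : X ∈ Matrix.unitaryGroup (Fin Nx) ℂ)
    (lam : ℕ → Fin Nx → ℂ)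
    (hΦ : ∀ ℓ < 4, Φ ℓ = X * Matrix.diagonal (lam ℓ) * Xᴴ)
    (hlam : ∀ ℓ, 1 ≤ ℓ → ℓ < 4 → ∀ k, ‖lam ℓ k‖ ≠ 1) :
    MGRIT.convergenceFactor m N Φ ≤
      ENNReal.ofReal (√(MGRIT.matNorm1 (MGRIT.diagonalizedPropagator m N lam) *
        MGRIT.matNormInf (MGRIT.diagonalizedPropagator m N lam))) ∧
    MGRIT.matNorm1 (MGRIT.diagonalizedPropagator m N lam) =
      (⨆ (s : Fin Nx × Fin (m 1 * m 2)),
        MGRIT.sCol (m 0) (m 1) (m 2) (N 3)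
          (lam 0 s.1) (lam 1 s.1) (lam 2 s.1) (lam 3 s.1) s.2) ∧
    MGRIT.matNormInf (MGRIT.diagonalizedPropagator m N lam) =
      (⨆ (s : Fin Nx × Fin (m 1 * m 2)),
        MGRIT.sRow (m 0) (m 1) (m 2) (N 3)
          (lam 0 s.1) (lam 1 s.1) (lam 2 s.1) (lam 3 s.1) (s.2 + 1)) ∧
    (∀ (k : Fin Nx) (p : Fin (N 1)), (p : ℕ) < m 1 * m 2 →
      MGRIT.absColSum (MGRIT.diagonalizedPropagator m N lam) (p, k) =
        MGRIT.sCol (m 0) (m 1) (m 2) (N 3) (lam 0 k) (lam 1 k) (lam 2 k) (lam 3 k) p) ∧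
    (∀ (k : Fin Nx) (p : Fin (N 1)) (t : ℕ), 1 ≤ t → (p : ℕ) + 1 + m 1 * m 2 = N 1 + t →
      MGRIT.absRowSum (MGRIT.diagonalizedPropagator m N lam) (p, k) =
        MGRIT.sRow (m 0) (m 1) (m 2) (N 3) (lam 0 k) (lam 1 k) (lam 2 k) (lam 3 k) t) := by
  have h := MGRIT.coarsening_of_card hm hN (by omega)
  have : NeZero Nx := ⟨by omega⟩
  exact ⟨MGRIT.convergenceFactor_le h hX hΦ, MGRIT.matNorm1_eq_iSup_sCol h hN3 hlam,
    MGRIT.matNormInf_eq_iSup_sRow h hN3 hlam,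
    fun k _ => MGRIT.absColSum_eq_sCol h hN3 hlam k,
    fun k _ _ => MGRIT.absRowSum_eq_sRow h hN3 hlam k⟩

theorem mainTheorem5 (Nx : ℕ) (hNx : 1 ≤ Nx) (m N : ℕ → ℕ)
    (hm : ∀ ℓ < 3, 1 ≤ m ℓ)
    (hN : ∀ ℓ < 3, N ℓ = m ℓ * (N (ℓ + 1) - 1) + 1)
    (hN3 : 2 ≤ N 3)
    (Φ : ℕ → Matrix (Fin Nx) (Fin Nx) ℂ)
    (X : Matrix (Fin Nx) (Fin Nx) ℂ) (hX : X ∈ Matrix.unitaryGroup (Fin Nx) ℂ)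
    (lam : ℕ → Fin Nx → ℂ)
    (hΦ : ∀ ℓ < 4, Φ ℓ = X * Matrix.diagonal (lam ℓ) * Xᴴ)
    (hlam : ∀ ℓ < 4, ∀ k, ‖lam ℓ k‖ < 1) :
    -- the bound on the worst-case convergence factor
    MGRIT.convergenceFactor m N Φ ≤
      ENNReal.ofReal (√(MGRIT.matNorm1 (MGRIT.diagonalizedPropagator m N lam) *
        MGRIT.matNormInf (MGRIT.diagonalizedPropagator m N lam))) ∧
    -- the two norms
    MGRIT.matNorm1 (MGRIT.diagonalizedPropagator m N lam) =
      (⨆ (s : Fin Nx × Fin (m 1 * m 2)),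
        MGRIT.sCol (m 0) (m 1) (m 2) (N 3)
          (lam 0 s.1) (lam 1 s.1) (lam 2 s.1) (lam 3 s.1) s.2) ∧
    MGRIT.matNormInf (MGRIT.diagonalizedPropagator m N lam) =
      (⨆ (s : Fin Nx × Fin (m 1 * m 2)),
        MGRIT.sRow (m 0) (m 1) (m 2) (N 3)
          (lam 0 s.1) (lam 1 s.1) (lam 2 s.1) (lam 3 s.1) (s.2 + 1)) ∧
    -- the absolute column sums of the first CF-interval on level 1
    (∀ (k : Fin Nx) (p : Fin (N 1)), (p : ℕ) < m 1 * m 2 →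
      MGRIT.absColSum (MGRIT.diagonalizedPropagator m N lam) (p, k) =
        MGRIT.sCol (m 0) (m 1) (m 2) (N 3) (lam 0 k) (lam 1 k) (lam 2 k) (lam 3 k) p) ∧
    -- the absolute row sums of the last FC-interval on level 1
    (∀ (k : Fin Nx) (p : Fin (N 1)) (t : ℕ), 1 ≤ t → (p : ℕ) + 1 + m 1 * m 2 = N 1 + t →
      MGRIT.absRowSum (MGRIT.diagonalizedPropagator m N lam) (p, k) =
        MGRIT.sRow (m 0) (m 1) (m 2) (N 3) (lam 0 k) (lam 1 k) (lam 2 k) (lam 3 k) t) := by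
  exact mainTheorem5_general Nx hNx m N hm hN hN3 Φ X hX lam hΦ fun ℓ _ hℓ k => (hlam ℓ hℓ k).ne
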